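/- Let $d,n\ge 0$ be integers, $w\in\mathbb R$, and let $x=(x^\mu)$ be coordinates on (a chart of) a $d$-dimensional manifold $M$. Let $W$ be an open subset of $\{(x,\rho)\}\subset\mathbb R^d\times\mathbb R$ and put $U=\{x:(x,0)\in W\}$. Let $\tilde g_{\mu\nu}(x,\rho)$ be a smooth field on $W$ of symmetric non-degenerate $d\times d$ matrices (a $\rho$-dependent metric on $M$, of any signature; ambient metrics in the sense of Fefferman–Graham are the main example), and equip $\mathbf M=\{(t,x,\rho): t>0,\ (x,\rho)\in W\}$ with the metric $$\mathbf g=2\rho\,dt^2+2t\,dt\,d\rho+t^2\tilde g_{\mu\nu}(x,\rho)\,dx^\mu dx^\nu ,$$ with Levi-Civita connection $\boldsymbol\nabla$. Put $\mathbf T=t\partial_t$, and write $\partial_\infty=\partial_\rho$. For a smooth function $f$ on $W$ let $f^{[m]}(x)=\frac1{m!}\partial_\rho^m f(x,0)$, $x\in U$; this is applied componentwise to fields, and $D^1u$ denotes the first jet $(u,\partial_\mu u)$ of a field $u$ on $U$. A $\rho$-dependent $n$-tractor of weight $w$ is a smooth field $\tilde X=(\tilde X_{I_1\dots I_n})$ on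 $W$, the indices $I_j$ ranging over $0,\mu,\infty$ (the coordinates $t,x^\mu,\rho$). It has exactly one smooth extension $\mathbf X$ to an $n$-covector field on $\mathbf M$ with $\mathcal L_{\mathbf T}\mathbf X=w\mathbf X$ and $\mathbf X|_{t=1}=\tilde X$. Define $\tilde\boxdot_w\tilde X=[\boldsymbol\nabla^I\boldsymbol\nabla_I\mathbf X]|_{t=1}$. Then, for every such $\tilde X$, $$\tilde\boxdot_w\tilde X=\tilde g^{\mu\nu}\partial_\mu\partial_\nu\tilde X+\left(d-2+2w-2n-2\rho\partial_\infty\right)\partial_\infty\tilde X+\tilde F\quad\text{on }W,$$ where $\tilde F$ is a smooth field on $W$ such that, for every $m\ge 0$, $\tilde F^{[m]}$ depends only on $D^1\tilde X^{[k]}$, $k\le m$: there are maps $\Phi_m(x,\cdot)$, linear in the jets, depending smoothly on $x\in U$, and not depending on $\tilde X$, with $$\tilde F^{[m]}(x)=\Phi_m\big(x,(D^1\tilde X^{[k]}(x))_{k\le m}\big)\qquad (x\in U).$$ In other words, for every $m\ge0$, on $U$, $$[\tilde\boxdot_w\tilde X]^{[m]}=[\tilde g^{\mu\nu}\partial_\mu\partial_\nu\tilde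 X]^{[m]}+(d-2+2w-2n-2m)(m+1)\tilde X^{[m+1]}+\tilde F^{[m]},$$ $$[\tilde g^{\mu\nu}\partial_\mu\partial_\nu\tilde X]^{[m]}=\sum_{k=0}^m[\tilde g^{\mu\nu}]^{[m-k]}\,\partial_\mu\partial_\nu\tilde X^{[k]},$$ so that $[\tilde\boxdot_w\tilde X]^{[m]}$ has principal part $[\tilde g^{\mu\nu}]^{[0]}\partial_\mu\partial_\nu\tilde X^{[m]}$ in $\tilde X^{[m]}$, contains second derivatives otherwise only of $\tilde X^{[k]}$ with $k<m$, and contains coefficients of order higher than $m$ only through the multiple $(d-2+2w-2n-2m)(m+1)$ of $\tilde X^{[m+1]}$ (the recursive, generalized hyperbolic structure). -/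

import Mathlib

open Set
open scoped ContDiff

noncomputable section

namespace AmbientTractor

/-- Index set of the coordinates `(t, x^μ, ρ)` of the ambient space: the index `0` (for `t`),
the indices `μ` of `M`, and the index `∞` (for `ρ`). -/
abbrev AIdx (d : ℕ) : Type := Unit ⊕ (Fin d ⊕ Unit)

/-- The ambient index `0`, of the coordinate `t`. -/
abbrev AIdx.zero (d : ℕ) : AIdx d := Sum.inl ()

/-- The ambient index of the coordinate `x^μ`. -/
abbrev AIdx.base {d : ℕ} (μ : Fin d) : AIdx d := Sum.inr (Sum.inl μ)

/-- The ambient index `∞`, of the coordinate `ρ`. -/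
abbrev AIdx.infty (d : ℕ) : AIdx d := Sum.inr (Sum.inr ())

/-- Points `x` of a coordinate chart of `M`. -/
abbrev BPoint (d : ℕ) : Type := Fin d → ℝ

/-- Points `(x, ρ)` of `M × ℝ`, in a coordinate chart of `M`. -/
abbrev TPoint (d : ℕ) : Type := BPoint d × ℝ

/-- Points `(t, (x, ρ))` of the ambient space. -/
abbrev APoint (d : ℕ) : Type := ℝ × TPoint d

/-- The components `X_{I₁ … Iₙ}` of an `n`-covector on the ambient space. -/
abbrev Comp (d n : ℕ) : Type := (Fin n → AIdx d) → ℝ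

/-- The coordinate vectors of the ambient space. -/
def coordVec {d : ℕ} : AIdx d → APoint d
  | Sum.inl _ => (1, 0, 0)
  | Sum.inr (Sum.inl μ) => (0, Pi.single μ 1, 0)
  | Sum.inr (Sum.inr _) => (0, 0, 1)

/-- The partial derivative `∂_I` on the ambient space. -/
def pd {d : ℕ} (I : AIdx d) (f : APoint d → ℝ) (p : APoint d) : ℝ :=
  fderiv ℝ f p (coordVec I)

/-- The ambient metric `2ρ dt² + 2t dt dρ + t² g̃_{μν}(x, ρ) dx^μ dx^ν`. -/
def ambientMetric {d : ℕ} (g : TPoint d → Matrix (Fin d) (Fin d) ℝ) (p : APoint d) :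
    Matrix (AIdx d) (AIdx d) ℝ
  | Sum.inl _, Sum.inl _ => 2 * p.2.2
  | Sum.inl _, Sum.inr (Sum.inr _) => p.1
  | Sum.inr (Sum.inr _), Sum.inl _ => p.1
  | Sum.inr (Sum.inl μ), Sum.inr (Sum.inl ν) => p.1 ^ 2 * g p.2 μ ν
  | _, _ => 0

section Metric

variable {d : ℕ} (G : APoint d → Matrix (AIdx d) (AIdx d) ℝ)

/-- The Christoffel symbol `Γ^K_{IJ}` of a metric `G` on the ambient space. -/
def christoffel (K I J : AIdx d) (p : APoint d) : ℝ :=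
  (1 / 2) * ∑ L, (G p)⁻¹ K L *
    (pd I (fun q => G q J L) p + pd J (fun q => G q I L) p - pd L (fun q => G q I J) p)

/-- The covariant derivative `∇_J X_{I₁ … Iₙ}` of an `n`-covector field, for the Levi-Civita
connection of `G`; the new index `J` is put in front. -/
def covDeriv {n : ℕ} (X : APoint d → Comp d n) (p : APoint d) : Comp d (n + 1) :=
  fun A => pd (A 0) (fun q => X q (Fin.tail A)) p -
    ∑ s : Fin n, ∑ L, christoffel G L (A 0) (Fin.tail A s) p *
      X p (Function.update (Fin.tail A) s L)

/-- The d'Alembert operator `∇^I ∇_I X_{I₁ … Iₙ}` of `G` on `n`-covector fields. -/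
def box {n : ℕ} (X : APoint d → Comp d n) (p : APoint d) : Comp d n :=
  fun A => ∑ I, ∑ J, (G p)⁻¹ I J *
    covDeriv G (covDeriv G X) p (Fin.cons I (Fin.cons J A))

end Metric

/-- The Lie derivative of an `n`-covector field `X` along a vector field `V`. -/
def lieDeriv {d n : ℕ} (V : APoint d → AIdx d → ℝ) (X : APoint d → Comp d n)
    (p : APoint d) : Comp d n :=
  fun A => (∑ J, V p J * pd J (fun q => X q A) p) +
    ∑ s : Fin n, ∑ J, X p (Function.update A s J) * pd (A s) (fun q => V q J) p

/-- The vector field `T = t ∂_t`. -/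
def eulerField {d : ℕ} (p : APoint d) : AIdx d → ℝ
  | Sum.inl _ => p.1
  | _ => 0

/-- The part `{t > 0, (x, ρ) ∈ W}` of the ambient space that lies over `W`. -/
def cone {d : ℕ} (W : Set (TPoint d)) : Set (APoint d) := {p | 0 < p.1 ∧ p.2 ∈ W}

/-- `X` is a smooth `n`-covector field on the ambient space over `W`, of weight `w`
(that is, `L_T X = w X`), whose restriction to `t = 1` is `Xt`. -/
structure IsWeightExtension {d n : ℕ} (W : Set (TPoint d)) (w : ℝ)
    (Xt : TPoint d → Comp d n) (X : APoint d → Comp d n) : Prop where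
  smooth : ContDiffOn ℝ ∞ X (cone W)
  weight : ∀ p ∈ cone W, lieDeriv eulerField X p = w • X p
  restrict : ∀ q ∈ W, X (1, q) = Xt q

/-- The restriction of an ambient field to `t = 1`. -/
def restrictOne {d n : ℕ} (X : APoint d → Comp d n) (q : TPoint d) : Comp d n := X (1, q)

/-- The derivative `∂_μ` of a field on `M × ℝ`. -/
def dBase {d n : ℕ} (μ : Fin d) (f : TPoint d → Comp d n) (q : TPoint d) : Comp d n :=
  fun A => fderiv ℝ (fun r => f r A) q (Pi.single μ 1, 0)

/-- The derivative `∂_∞ = ∂_ρ` of a field on `M × ℝ`. -/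
def dInf {d n : ℕ} (f : TPoint d → Comp d n) (q : TPoint d) : Comp d n :=
  fun A => fderiv ℝ (fun r => f r A) q (0, 1)

/-- The principal part `g̃^{μν} ∂_μ ∂_ν f`. -/
def principal {d n : ℕ} (g : TPoint d → Matrix (Fin d) (Fin d) ℝ) (f : TPoint d → Comp d n)
    (q : TPoint d) : Comp d n :=
  ∑ μ, ∑ ν, (g q)⁻¹ μ ν • dBase μ (dBase ν f) q

/-- The coefficient `φ^{[m]}(x)` of `ρ^m` in the Taylor expansion at `ρ = 0` of a function
`φ` on `M × ℝ`. -/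
def scoeff {d : ℕ} (m : ℕ) (φ : TPoint d → ℝ) (x : BPoint d) : ℝ :=
  (m.factorial : ℝ)⁻¹ * iteratedDeriv m (fun ρ : ℝ => φ (x, ρ)) 0

/-- The Taylor coefficient `f^{[m]}` of a field `f` on `M × ℝ`, componentwise. -/
def coeff {d n : ℕ} (m : ℕ) (f : TPoint d → Comp d n) (x : BPoint d) : Comp d n :=
  fun A => scoeff m (fun q => f q A) x

/-- The derivative `∂_μ` of a field on `M`. -/
def dM {d n : ℕ} (μ : Fin d) (u : BPoint d → Comp d n) (x : BPoint d) : Comp d n :=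
  fun A => fderiv ℝ (fun y => u y A) x (Pi.single μ 1)

/-- The space of first jets at a point of `M` of fields with values in `Comp d n`: the value
and the first partial derivatives. -/
abbrev Jet1 (d n : ℕ) : Type := Comp d n × (Fin d → Comp d n)

/-- The first jet `D¹u(x)` of a field on `M`. -/
def jet1 {d n : ℕ} (u : BPoint d → Comp d n) (x : BPoint d) : Jet1 d n :=
  (u x, fun μ => dM μ u x)

end AmbientTractor

end

/-! Write z(A) for the number of indices 0 in A. Since `T = t ∂_t`, the weight condition is the ODE
`t ∂_t X_A = (w - z(A)) X_A`, so the extension is `X_A = t ^ (w - z(A)) * Xt_A` (`apply_eq`): it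
exists, is unique on the cone, and at `t = 1` the derivative `∂_0` is multiplication by w - z(A).

Expanding `∇^I ∇_I` in coordinates (`box_eq`) leaves one question: which terms contain `∂_∞` without
a factor ρ? At `t = 1` the only nonzero inverse entries are g^{0∞} = 1, g^{∞∞} = -2ρ and g̃^{μν}.
There are three sources. The second-order part 2 g^{0∞} ∂_0 ∂_∞ gives 2(w - z(A)). The mixed
connection terms give -2(n - z(A)), because Γ^L_{0J} is δ^L_J / t for J ≠ 0 and vanishes for J = 0
(`christoffel_zero`). The contraction g^{IJ} Γ^∞_{IJ} = 2 - d + ρ g̃^{μν} ∂_ρ g̃_{μν} enters with a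
minus sign and gives d - 2 (`contractedChristoffel_infty`). In the sum z(A) cancels, so the
coefficient d - 2 + 2w - 2n is the same for all components; g^{∞∞} ∂_∞² supplies -2ρ ∂_∞².

What remains consists of X, `∂_μ X` and ρ `∂_∞ X` with smooth coefficients. On Taylor coefficients,
ρ ∂_ρ multiplies the m-th one by m, `∂_μ` commutes with taking them, and by Leibniz multiplication
by a smooth function involves only orders at most m. Hence the remainder is triangular
(`IsJetTriangular`). -/

noncomputable section

namespace AmbientTractor

open Filter Topology

/-! ### Derivatives of smooth functions on open sets. -/

section Calculus

variable {E : Type*} [NormedAddCommGroup E] [NormedSpace ℝ E]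

lemma contDiffOn_fderiv_apply {S : Set E} (hS : IsOpen S) {f : E → ℝ}
    (hf : ContDiffOn ℝ ∞ f S) (v : E) : ContDiffOn ℝ ∞ (fun q => fderiv ℝ f q v) S :=
  (hf.fderiv_of_isOpen hS (by simp)).clm_apply contDiffOn_const

lemma contDiffAt_of_mem {S : Set E} (hS : IsOpen S) {f : E → ℝ}
    (hf : ContDiffOn ℝ ∞ f S) {p : E} (hp : p ∈ S) : ContDiffAt ℝ ∞ f p :=
  hf.contDiffAt (hS.mem_nhds hp)

lemma differentiableAt_of_mem {S : Set E} (hS : IsOpen S) {f : E → ℝ}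
    (hf : ContDiffOn ℝ ∞ f S) {p : E} (hp : p ∈ S) : DifferentiableAt ℝ f p :=
  (contDiffAt_of_mem hS hf hp).differentiableAt (by simp)

lemma fderiv_congr_of_eqOn {S : Set E} (hS : IsOpen S) {f f' : E → ℝ} (h : EqOn f f' S)
    {p : E} (hp : p ∈ S) : fderiv ℝ f p = fderiv ℝ f' p :=
  (h.eventuallyEq_of_mem (hS.mem_nhds hp)).fderiv_eq

lemma fderiv_fderiv_comm {S : Set E} (hS : IsOpen S) {f : E → ℝ}
    (hf : ContDiffOn ℝ ∞ f S) {p : E} (hp : p ∈ S) (v u : E) :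
    fderiv ℝ (fun q => fderiv ℝ f q v) p u = fderiv ℝ (fun q => fderiv ℝ f q u) p v := by
  have h2 : DifferentiableAt ℝ (fderiv ℝ f) p :=
    ((hf.fderiv_of_isOpen (m := ∞) hS (by simp)).contDiffAt (hS.mem_nhds hp)).differentiableAt
      (by simp)
  have key : ∀ a b : E, fderiv ℝ (fun q => fderiv ℝ f q a) p b = fderiv ℝ (fderiv ℝ f) p b a := by
    intro a b
    rw [fderiv_clm_apply h2 (differentiableAt_const a)]
    simp
  rw [key, key]
  exact ((contDiffAt_of_mem hS hf hp).isSymmSndFDerivAt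
    (by simpa using (WithTop.coe_le_coe.mpr le_top : ((2 : ℕ∞) : WithTop ℕ∞) ≤ ∞))).eq u v

end Calculus

/-! ### Taylor coefficients in ρ along the slice ρ = 0. -/

variable {d n : ℕ}

/-- The derivative `∂_ρ` of a function on `M × ℝ`. -/
def rhoDeriv (φ : TPoint d → ℝ) (q : TPoint d) : ℝ := fderiv ℝ φ q (0, 1)

lemma isOpen_zeroSlice {W : Set (TPoint d)} (hW : IsOpen W) :
    IsOpen {x : BPoint d | (x, (0 : ℝ)) ∈ W} :=
  hW.preimage (by fun_prop)

lemma contDiffOn_rhoDeriv {W : Set (TPoint d)} (hW : IsOpen W) {φ : TPoint d → ℝ}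
    (hφ : ContDiffOn ℝ ∞ φ W) : ContDiffOn ℝ ∞ (rhoDeriv φ) W :=
  contDiffOn_fderiv_apply hW hφ _

lemma contDiffOn_rhoDeriv_iterate {W : Set (TPoint d)} (hW : IsOpen W) {φ : TPoint d → ℝ}
    (hφ : ContDiffOn ℝ ∞ φ W) (m : ℕ) : ContDiffOn ℝ ∞ (rhoDeriv^[m] φ) W := by
  induction m with
  | zero => exact hφ
  | succ m ih =>
    rw [Function.iterate_succ_apply']
    exact contDiffOn_fderiv_apply hW ih _

lemma mem_nhds_slice {W : Set (TPoint d)} (hW : IsOpen W) {x : BPoint d} {ρ : ℝ}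
    (h : (x, ρ) ∈ W) : ∀ᶠ r in 𝓝 ρ, (x, r) ∈ W :=
  (hW.preimage (f := fun r : ℝ => ((x, r) : TPoint d)) (by fun_prop)).mem_nhds h

/-- Trades one-variable derivatives along a slice for iterated partial derivatives on the open set
`W`, where smoothness in x and the symmetry of mixed partials are available. -/
lemma iteratedDeriv_slice {W : Set (TPoint d)} (hW : IsOpen W) {φ : TPoint d → ℝ}
    (hφ : ContDiffOn ℝ ∞ φ W) (m : ℕ) {x : BPoint d} {ρ : ℝ} (h : (x, ρ) ∈ W) :
    iteratedDeriv m (fun r : ℝ => φ (x, r)) ρ = (rhoDeriv^[m] φ) (x, ρ) := by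
  -- The next derivative needs the identity at all nearby ρ, not only at the given one.
  induction m generalizing ρ with
  | zero => simp
  | succ m ih =>
    rw [iteratedDeriv_succ, Function.iterate_succ_apply']
    have h1 : iteratedDeriv m (fun r : ℝ => φ (x, r)) =ᶠ[𝓝 ρ]
        fun r => (rhoDeriv^[m] φ) (x, r) :=
      (mem_nhds_slice hW h).mono fun r hr => ih hr
    rw [h1.deriv_eq]
    have h2 := (differentiableAt_of_mem hW (contDiffOn_rhoDeriv_iterate hW hφ m) h).hasFDerivAt
    have h3 : HasDerivAt (fun r : ℝ => ((x, r) : TPoint d)) (0, 1) ρ :=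
      (hasDerivAt_const ρ x).prodMk (hasDerivAt_id ρ)
    exact (h2.comp_hasDerivAt ρ h3).deriv

lemma scoeff_eq_iterate {W : Set (TPoint d)} (hW : IsOpen W) {φ : TPoint d → ℝ}
    (hφ : ContDiffOn ℝ ∞ φ W) (m : ℕ) {x : BPoint d} (h : (x, (0 : ℝ)) ∈ W) :
    scoeff m φ x = (m.factorial : ℝ)⁻¹ * (rhoDeriv^[m] φ) (x, 0) := by
  rw [scoeff, iteratedDeriv_slice hW hφ m h]

lemma contDiffOn_scoeff {W : Set (TPoint d)} (hW : IsOpen W) {φ : TPoint d → ℝ}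
    (hφ : ContDiffOn ℝ ∞ φ W) (m : ℕ) :
    ContDiffOn ℝ ∞ (scoeff m φ) {x | (x, (0 : ℝ)) ∈ W} := by
  have h : ContDiffOn ℝ ∞ (fun x : BPoint d => (m.factorial : ℝ)⁻¹ * (rhoDeriv^[m] φ) (x, 0))
      {x | (x, (0 : ℝ)) ∈ W} :=
    contDiffOn_const.mul ((contDiffOn_rhoDeriv_iterate hW hφ m).comp (by fun_prop) fun x hx => hx)
  exact h.congr fun x hx => scoeff_eq_iterate hW hφ m hx

lemma scoeff_congr {W : Set (TPoint d)} (hW : IsOpen W) {φ ψ : TPoint d → ℝ} (h : EqOn φ ψ W)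
    (m : ℕ) {x : BPoint d} (hx : (x, (0 : ℝ)) ∈ W) : scoeff m φ x = scoeff m ψ x := by
  rw [scoeff, scoeff]
  congr 1
  exact Filter.EventuallyEq.iteratedDeriv_eq m ((mem_nhds_slice hW hx).mono fun r hr => h hr)

lemma contDiffAt_slice {W : Set (TPoint d)} (hW : IsOpen W) {φ : TPoint d → ℝ}
    (hφ : ContDiffOn ℝ ∞ φ W) (m : ℕ) {x : BPoint d} (h : (x, (0 : ℝ)) ∈ W) :
    ContDiffAt ℝ m (fun r : ℝ => φ (x, r)) 0 := by
  have h1 : ContDiffAt ℝ ∞ φ (x, (0 : ℝ)) := contDiffAt_of_mem hW hφ h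
  have h2 : ContDiffAt ℝ ∞ (fun r : ℝ => φ (x, r)) 0 :=
    ContDiffAt.comp (0 : ℝ) (g := φ) (f := fun r : ℝ => ((x, r) : TPoint d)) h1 (by fun_prop)
  exact h2.of_le (by exact_mod_cast le_top)

lemma scoeff_add {W : Set (TPoint d)} (hW : IsOpen W) {φ ψ : TPoint d → ℝ}
    (hφ : ContDiffOn ℝ ∞ φ W) (hψ : ContDiffOn ℝ ∞ ψ W) (m : ℕ) {x : BPoint d}
    (h : (x, (0 : ℝ)) ∈ W) :
    scoeff m (fun q => φ q + ψ q) x = scoeff m φ x + scoeff m ψ x := by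
  rw [scoeff, scoeff, scoeff, iteratedDeriv_fun_add (contDiffAt_slice hW hφ m h)
    (contDiffAt_slice hW hψ m h), mul_add]

lemma scoeff_mul {W : Set (TPoint d)} (hW : IsOpen W) {φ ψ : TPoint d → ℝ}
    (hφ : ContDiffOn ℝ ∞ φ W) (hψ : ContDiffOn ℝ ∞ ψ W) (m : ℕ) {x : BPoint d}
    (h : (x, (0 : ℝ)) ∈ W) :
    scoeff m (fun q => φ q * ψ q) x =
      ∑ k ∈ Finset.range (m + 1), scoeff (m - k) φ x * scoeff k ψ x := by
  -- The factors are swapped so that the Leibniz index k counts the derivatives that fall on ψ.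
  simp_rw [mul_comm (φ _)]
  rw [scoeff, iteratedDeriv_fun_mul (contDiffAt_slice hW hψ m h) (contDiffAt_slice hW hφ m h),
    Finset.mul_sum]
  refine Finset.sum_congr rfl fun k hk => ?_
  have hk' : k ≤ m := Nat.lt_succ_iff.mp (Finset.mem_range.mp hk)
  rw [scoeff, scoeff, Nat.cast_choose ℝ hk']
  have := Nat.factorial_ne_zero m
  have := Nat.factorial_ne_zero k
  have := Nat.factorial_ne_zero (m - k)
  field_simp

lemma scoeff_const_mul {W : Set (TPoint d)} (hW : IsOpen W) {φ : TPoint d → ℝ}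
    (hφ : ContDiffOn ℝ ∞ φ W) (c : ℝ) (m : ℕ) {x : BPoint d} (h : (x, (0 : ℝ)) ∈ W) :
    scoeff m (fun q => c * φ q) x = c * scoeff m φ x := by
  have := iteratedDeriv_const_smul (contDiffAt_slice hW hφ m h) c
  rw [scoeff, scoeff, mul_left_comm]
  exact congrArg _ this

lemma scoeff_sum {W : Set (TPoint d)} (hW : IsOpen W) {ι : Type*} (s : Finset ι)
    {φ : ι → TPoint d → ℝ} (hφ : ∀ i, ContDiffOn ℝ ∞ (φ i) W) (m : ℕ) {x : BPoint d}
    (h : (x, (0 : ℝ)) ∈ W) :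
    scoeff m (fun q => ∑ i ∈ s, φ i q) x = ∑ i ∈ s, scoeff m (φ i) x := by
  classical
  induction s using Finset.induction_on with
  | empty => simp [scoeff]
  | insert a s ha ih =>
    simp only [Finset.sum_insert ha]
    rw [scoeff_add hW (hφ a) (ContDiffOn.sum fun i _ => hφ i) m h, ih]

lemma scoeff_rhoDeriv {W : Set (TPoint d)} (hW : IsOpen W) {φ : TPoint d → ℝ}
    (hφ : ContDiffOn ℝ ∞ φ W) (m : ℕ) {x : BPoint d} (h : (x, (0 : ℝ)) ∈ W) :
    scoeff m (rhoDeriv φ) x = ((m : ℝ) + 1) * scoeff (m + 1) φ x := by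
  rw [scoeff_eq_iterate hW (contDiffOn_rhoDeriv hW hφ) m h, scoeff_eq_iterate hW hφ _ h,
    Function.iterate_succ_apply, Nat.factorial_succ]
  have := Nat.factorial_ne_zero m
  push_cast
  field_simp

/-- The Euler operator ρ ∂_ρ is diagonal on powers of ρ: the factor ρ undoes the shift of order
caused by ∂_ρ. This is why `∂_∞` may occur in the remainder, but only multiplied by ρ. -/
lemma scoeff_snd_mul_rhoDeriv {W : Set (TPoint d)} (hW : IsOpen W) {φ : TPoint d → ℝ}
    (hφ : ContDiffOn ℝ ∞ φ W) (m : ℕ) {x : BPoint d} (h : (x, (0 : ℝ)) ∈ W) :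
    scoeff m (fun q => q.2 * rhoDeriv φ q) x = (m : ℝ) * scoeff m φ x := by
  rw [scoeff_mul hW (by fun_prop) (contDiffOn_rhoDeriv hW hφ) m h]
  have hc : ∀ j, scoeff j (fun q : TPoint d => q.2) x = if j = 1 then 1 else 0 := by
    intro j
    rw [scoeff, iteratedDeriv_fun_id_zero]
    split_ifs with hj <;> simp [hj]
  -- For order 0 both sides vanish. For order m + 1 the function ρ has only its first Taylor
  -- coefficient, so only the Leibniz term k = m survives.
  cases m with
  | zero => simp [hc]
  | succ m =>
    rw [Finset.sum_eq_single m]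
    · rw [hc, scoeff_rhoDeriv hW hφ m h]
      simp
    · intro k hk hkm
      rw [hc, if_neg, zero_mul]
      have := Finset.mem_range.mp hk
      omega
    · simp

lemma rhoDeriv_iterate_fderiv {W : Set (TPoint d)} (hW : IsOpen W) {φ : TPoint d → ℝ}
    (hφ : ContDiffOn ℝ ∞ φ W) (m : ℕ) (v : TPoint d) :
    EqOn (rhoDeriv^[m] fun q => fderiv ℝ φ q v) (fun q => fderiv ℝ (rhoDeriv^[m] φ) q v) W := by
  induction m with
  | zero => exact fun q _ => rfl
  | succ m ih =>
    intro q hq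
    simp only [Function.iterate_succ_apply']
    rw [rhoDeriv, fderiv_congr_of_eqOn hW ih hq]
    exact fderiv_fderiv_comm hW (contDiffOn_rhoDeriv_iterate hW hφ m) hq _ _

/-- By symmetry of mixed partials ∂_ρ^m commutes with derivatives along the base. This turns
x-derivatives of the field into derivatives of its Taylor coefficients, that is, into jets. -/
lemma scoeff_fderiv_base {W : Set (TPoint d)} (hW : IsOpen W) {φ : TPoint d → ℝ}
    (hφ : ContDiffOn ℝ ∞ φ W) (m : ℕ) (v : BPoint d) {x : BPoint d} (h : (x, (0 : ℝ)) ∈ W) :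
    scoeff m (fun q => fderiv ℝ φ q (v, 0)) x = fderiv ℝ (scoeff m φ) x v := by
  rw [scoeff_eq_iterate hW (contDiffOn_fderiv_apply hW hφ _) m h,
    rhoDeriv_iterate_fderiv hW hφ m _ h,
    fderiv_congr_of_eqOn (isOpen_zeroSlice hW) (fun y hy => scoeff_eq_iterate hW hφ m hy) h]
  have h2 := (differentiableAt_of_mem hW (contDiffOn_rhoDeriv_iterate hW hφ m) h).hasFDerivAt
  have h3 : HasFDerivAt (fun y : BPoint d => ((y, 0) : TPoint d))
      (ContinuousLinearMap.inl ℝ (BPoint d) ℝ) x := hasFDerivAt_prodMk_left x 0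
  have h4 := (h2.comp x h3).const_mul (m.factorial : ℝ)⁻¹
  rw [show (fun y : BPoint d => (m.factorial : ℝ)⁻¹ * (rhoDeriv^[m] φ) (y, 0)) =
    fun y => (m.factorial : ℝ)⁻¹ * ((rhoDeriv^[m] φ) ∘ fun y : BPoint d => ((y, 0) : TPoint d)) y
    from rfl, h4.fderiv]
  simp

lemma coeff_dBase {W : Set (TPoint d)} (hW : IsOpen W) {f : TPoint d → Comp d n}
    (hf : ContDiffOn ℝ ∞ f W) (m : ℕ) (μ : Fin d) {x : BPoint d} (h : (x, (0 : ℝ)) ∈ W) :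
    coeff m (dBase μ f) x = dM μ (coeff m f) x := by
  funext A
  exact scoeff_fderiv_base hW (contDiffOn_pi.mp hf A) m _ h

lemma contDiffOn_dBase {W : Set (TPoint d)} (hW : IsOpen W) {f : TPoint d → Comp d n}
    (hf : ContDiffOn ℝ ∞ f W) (μ : Fin d) : ContDiffOn ℝ ∞ (dBase μ f) W :=
  contDiffOn_pi.mpr fun A => contDiffOn_fderiv_apply hW (contDiffOn_pi.mp hf A) _

lemma contDiffOn_dInf {W : Set (TPoint d)} (hW : IsOpen W) {f : TPoint d → Comp d n}
    (hf : ContDiffOn ℝ ∞ f W) : ContDiffOn ℝ ∞ (dInf f) W :=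
  contDiffOn_pi.mpr fun A => contDiffOn_fderiv_apply hW (contDiffOn_pi.mp hf A) _

lemma dM_congr {W : Set (TPoint d)} (hW : IsOpen W) {u v : BPoint d → Comp d n}
    (h : ∀ x, (x, (0 : ℝ)) ∈ W → u x = v x) (μ : Fin d) {x : BPoint d}
    (hx : (x, (0 : ℝ)) ∈ W) : dM μ u x = dM μ v x := by
  funext A
  rw [dM, dM, fderiv_congr_of_eqOn (isOpen_zeroSlice hW) (fun y hy => congrFun (h y hy) A) hx]

/-- The Taylor coefficients of the principal part. -/
lemma coeff_principal {W : Set (TPoint d)} (hW : IsOpen W)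
    {g : TPoint d → Matrix (Fin d) (Fin d) ℝ}
    (hg : ∀ μ ν, ContDiffOn ℝ ∞ (fun q => (g q)⁻¹ μ ν) W) {f : TPoint d → Comp d n}
    (hf : ContDiffOn ℝ ∞ f W) (m : ℕ) {x : BPoint d} (h : (x, (0 : ℝ)) ∈ W) :
    coeff m (principal g f) x = ∑ k ∈ Finset.range (m + 1), ∑ μ, ∑ ν,
      scoeff (m - k) (fun q => (g q)⁻¹ μ ν) x • dM μ (dM ν (coeff k f)) x := by
  funext A
  have hs : ∀ μ ν, ContDiffOn ℝ ∞ (fun q => dBase μ (dBase ν f) q A) W := fun μ ν =>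
    contDiffOn_pi.mp (contDiffOn_dBase hW (contDiffOn_dBase hW hf ν) μ) A
  have h1 : coeff m (principal g f) x A = scoeff m (fun q => ∑ μ, ∑ ν,
      (g q)⁻¹ μ ν * dBase μ (dBase ν f) q A) x := by
    simp [coeff, principal, Finset.sum_apply]
  rw [h1, scoeff_sum hW _ (fun μ => ContDiffOn.sum fun ν _ => (hg μ ν).mul (hs μ ν)) m h]
  simp only [Finset.sum_apply, Pi.smul_apply, smul_eq_mul]
  rw [Finset.sum_comm]
  refine Finset.sum_congr rfl fun μ _ => ?_
  rw [scoeff_sum hW _ (fun ν => (hg μ ν).mul (hs μ ν)) m h, Finset.sum_comm]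
  refine Finset.sum_congr rfl fun ν _ => ?_
  rw [scoeff_mul hW (hg μ ν) (hs μ ν) m h]
  refine Finset.sum_congr rfl fun k _ => ?_
  congr 1
  have h2 := congrFun (coeff_dBase hW (contDiffOn_dBase hW hf ν) k μ h) A
  -- The inner commutation holds on the whole open slice, so it may be differentiated once more.
  have h3 := congrFun (dM_congr hW (fun y hy => coeff_dBase hW hf k ν hy) μ h) A
  exact h2.trans h3

end AmbientTractor

/-! ### Operators that are triangular in the Taylor order. -/

namespace AmbientTractor

variable {d n : ℕ}

/-- An operator `L` from fields to functions on `W` whose `m`-th Taylor coefficient is a linear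
function, with smooth coefficients, of the first jets of the Taylor coefficients of order at
most `m` of the field. -/
def IsJetTriangular (W : Set (TPoint d)) (L : (TPoint d → Comp d n) → TPoint d → ℝ) : Prop :=
  (∀ Xt, ContDiffOn ℝ ∞ Xt W → ContDiffOn ℝ ∞ (L Xt) W) ∧
  ∃ Φ : ∀ m : ℕ, BPoint d → ((Fin (m + 1) → Jet1 d n) →L[ℝ] ℝ),
    (∀ m, ContDiffOn ℝ ∞ (Φ m) {x | (x, (0 : ℝ)) ∈ W}) ∧
    ∀ Xt, ContDiffOn ℝ ∞ Xt W → ∀ (m : ℕ) (x : BPoint d), (x, (0 : ℝ)) ∈ W →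
      scoeff m (L Xt) x = Φ m x (fun k => jet1 (coeff (k : ℕ) Xt) x)

namespace IsJetTriangular

variable {W : Set (TPoint d)} {L L' : (TPoint d → Comp d n) → TPoint d → ℝ}

lemma zero : IsJetTriangular W (fun (_ : TPoint d → Comp d n) _ => 0) :=
  ⟨fun _ _ => contDiffOn_const, fun _ _ => 0, fun _ => contDiffOn_const,
    fun _ _ _ _ _ => by simp [scoeff]⟩

lemma add (hW : IsOpen W) (hL : IsJetTriangular W L) (hL' : IsJetTriangular W L') :
    IsJetTriangular W (fun Xt q => L Xt q + L' Xt q) := by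
  obtain ⟨h1, Φ, h2, h3⟩ := hL
  obtain ⟨h1', Φ', h2', h3'⟩ := hL'
  refine ⟨fun Xt hX => (h1 Xt hX).add (h1' Xt hX), fun m x => Φ m x + Φ' m x,
    fun m => (h2 m).add (h2' m), fun Xt hX m x hx => ?_⟩
  rw [scoeff_add hW (h1 Xt hX) (h1' Xt hX) m hx, h3 Xt hX m x hx, h3' Xt hX m x hx]
  rfl

/-- By Leibniz, order m of the product uses only the orders k ≤ m of `L Xt`, each depending on jets
of order at most k. -/
lemma mul (hW : IsOpen W) {φ : TPoint d → ℝ} (hφ : ContDiffOn ℝ ∞ φ W)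
    (hL : IsJetTriangular W L) : IsJetTriangular W (fun Xt q => φ q * L Xt q) := by
  obtain ⟨h1, Φ, h2, h3⟩ := hL
  -- Truncation: forgets the jets of order above k, so that `Φ k` can be applied.
  let S : ∀ (m : ℕ) (k : Fin (m + 1)),
      (Fin (m + 1) → Jet1 d n) →L[ℝ] (Fin ((k : ℕ) + 1) → Jet1 d n) := fun m k =>
    ContinuousLinearMap.pi fun j =>
      ContinuousLinearMap.proj (⟨j, lt_of_lt_of_le j.2 k.2⟩ : Fin (m + 1))
  refine ⟨fun Xt hX => hφ.mul (h1 Xt hX),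
    fun m x => ∑ k : Fin (m + 1), scoeff (m - k) φ x • (Φ k x).comp (S m k),
    fun m => ContDiffOn.sum fun k _ => (contDiffOn_scoeff hW hφ _).smul
      ((h2 k).clm_comp contDiffOn_const), fun Xt hX m x hx => ?_⟩
  rw [scoeff_mul hW hφ (h1 Xt hX) m hx, Finset.sum_range, sum_apply]
  refine Finset.sum_congr rfl fun k _ => ?_
  rw [h3 Xt hX k x hx]
  rfl

lemma const_mul (hW : IsOpen W) (c : ℝ) (hL : IsJetTriangular W L) :
    IsJetTriangular W (fun Xt q => c * L Xt q) :=
  hL.mul hW contDiffOn_const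

lemma sum (hW : IsOpen W) {ι : Type*} (s : Finset ι)
    {L : ι → (TPoint d → Comp d n) → TPoint d → ℝ} (hL : ∀ i ∈ s, IsJetTriangular W (L i)) :
    IsJetTriangular W (fun Xt q => ∑ i ∈ s, L i Xt q) := by
  classical
  induction s using Finset.induction_on with
  | empty => simpa using zero
  | insert a s ha ih =>
    simp only [Finset.sum_insert ha]
    exact (hL a (by simp)).add hW (ih fun i hi => hL i (by simp [hi]))

lemma component (B : Fin n → AIdx d) :
    IsJetTriangular W (fun (Xt : TPoint d → Comp d n) q => Xt q B) :=
  ⟨fun _ hX => contDiffOn_pi.mp hX B,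
    fun m _ => (ContinuousLinearMap.proj (R := ℝ) B).comp
      ((ContinuousLinearMap.fst ℝ (Comp d n) (Fin d → Comp d n)).comp
        (ContinuousLinearMap.proj (φ := fun _ : Fin (m + 1) => Jet1 d n) (Fin.last m))),
    fun _ => contDiffOn_const, fun _ _ _ _ _ => rfl⟩

lemma dBase_component (hW : IsOpen W) (μ : Fin d) (B : Fin n → AIdx d) :
    IsJetTriangular W (fun (Xt : TPoint d → Comp d n) q => dBase μ Xt q B) :=
  ⟨fun _ hX => contDiffOn_pi.mp (contDiffOn_dBase hW hX μ) B,
    fun m _ => (ContinuousLinearMap.proj (R := ℝ) B).comp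
      ((ContinuousLinearMap.proj (R := ℝ) μ).comp
        ((ContinuousLinearMap.snd ℝ (Comp d n) (Fin d → Comp d n)).comp
          (ContinuousLinearMap.proj (φ := fun _ : Fin (m + 1) => Jet1 d n) (Fin.last m)))),
    fun _ => contDiffOn_const, fun _ hX m _ hx => congrFun (coeff_dBase hW hX m μ hx) B⟩

lemma snd_mul_dInf_component (hW : IsOpen W) (B : Fin n → AIdx d) :
    IsJetTriangular W (fun (Xt : TPoint d → Comp d n) q => q.2 * dInf Xt q B) :=
  ⟨fun _ hX => (contDiff_snd.contDiffOn).mul (contDiffOn_pi.mp (contDiffOn_dInf hW hX) B),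
    fun m _ => (m : ℝ) • (ContinuousLinearMap.proj (R := ℝ) B).comp
      ((ContinuousLinearMap.fst ℝ (Comp d n) (Fin d → Comp d n)).comp
        (ContinuousLinearMap.proj (φ := fun _ : Fin (m + 1) => Jet1 d n) (Fin.last m))),
    fun _ => contDiffOn_const,
    fun _ hX m _ hx => scoeff_snd_mul_rhoDeriv hW (contDiffOn_pi.mp hX B) m hx⟩

end IsJetTriangular

end AmbientTractor

/-! ### The d'Alembert operator of a general metric, in coordinates. -/

namespace AmbientTractor

variable {d n : ℕ}

section Box

variable {G : APoint d → Matrix (AIdx d) (AIdx d) ℝ} {S : Set (APoint d)}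

/-- The part of `∇^I ∇_I X` that involves no derivative of `X`, as a function of the
components `Y` of `X` at the point `p`. -/
def boxZeroth (G : APoint d → Matrix (AIdx d) (AIdx d) ℝ) (A : Fin n → AIdx d) (p : APoint d)
    (Y : Comp d n) : ℝ :=
  ∑ I, ∑ J, (G p)⁻¹ I J *
    ((∑ s, ∑ L, -pd I (christoffel G L J (A s)) p * Y (Function.update A s L)) +
      ((∑ L, christoffel G L I J p *
          ∑ s, ∑ K, christoffel G K L (A s) p * Y (Function.update A s K)) +
        ∑ s, ∑ L, christoffel G L I (A s) p *
          ∑ s', ∑ K, christoffel G K J (Function.update A s L s') p *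
            Y (Function.update (Function.update A s L) s' K)))

lemma covDeriv_cons (X : APoint d → Comp d n) (p : APoint d) (J : AIdx d)
    (A : Fin n → AIdx d) :
    covDeriv G X p (Fin.cons J A) = pd J (fun q => X q A) p -
      ∑ s, ∑ L, christoffel G L J (A s) p * X p (Function.update A s L) := rfl

lemma covDeriv_covDeriv_cons (X : APoint d → Comp d n) (p : APoint d) (I J : AIdx d)
    (A : Fin n → AIdx d) :
    covDeriv G (covDeriv G X) p (Fin.cons I (Fin.cons J A)) =
      pd I (fun q => covDeriv G X q (Fin.cons J A)) p -
      ((∑ L, christoffel G L I J p * covDeriv G X p (Fin.cons L A)) +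
        ∑ s, ∑ L, christoffel G L I (A s) p *
          covDeriv G X p (Fin.cons J (Function.update A s L))) := by
  -- The slot of the inner derivative index J is separated from the n original slots; it produces
  -- the term with Γ^L_{IJ}.
  rw [covDeriv_cons, Fin.sum_univ_succ]
  simp only [Fin.cons_zero, Fin.cons_succ, Fin.update_cons_zero, Fin.cons_update]

lemma pd_covDeriv_cons (hS : IsOpen S)
    (hΓ : ∀ K I J, ContDiffOn ℝ ∞ (christoffel G K I J) S) {X : APoint d → Comp d n}
    (hX : ∀ B, ContDiffOn ℝ ∞ (fun q => X q B) S) {p : APoint d} (hp : p ∈ S) (I J : AIdx d)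
    (A : Fin n → AIdx d) :
    pd I (fun q => covDeriv G X q (Fin.cons J A)) p =
      pd I (pd J fun q => X q A) p - ∑ s, ∑ L,
        (pd I (christoffel G L J (A s)) p * X p (Function.update A s L) +
          christoffel G L J (A s) p * pd I (fun q => X q (Function.update A s L)) p) := by
  have h1 : HasFDerivAt (pd J fun q => X q A) _ p :=
    (differentiableAt_of_mem hS (contDiffOn_fderiv_apply hS (hX A) (coordVec J)) hp).hasFDerivAt
  have h2 : ∀ s L, HasFDerivAt
      (fun q => christoffel G L J (A s) q * X q (Function.update A s L)) _ p := fun s L =>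
    (differentiableAt_of_mem hS (hΓ L J (A s)) hp).hasFDerivAt.mul
      (differentiableAt_of_mem hS (hX (Function.update A s L)) hp).hasFDerivAt
  have h3 := h1.sub (HasFDerivAt.fun_sum (u := Finset.univ) fun s _ =>
    HasFDerivAt.fun_sum (u := Finset.univ) fun L _ => h2 s L)
  have h4 : fderiv ℝ (fun q => covDeriv G X q (Fin.cons J A)) p = _ := h3.fderiv
  rw [pd, h4]
  simp only [sub_apply, sum_apply,
    add_apply, smul_apply, smul_eq_mul]
  congr 1
  refine Finset.sum_congr rfl fun s _ => Finset.sum_congr rfl fun L _ => ?_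
  simp only [pd]
  ring

/-- The d'Alembert operator in coordinates, sorted by the order of the derivatives. -/
lemma box_eq (hS : IsOpen S)
    (hΓ : ∀ K I J, ContDiffOn ℝ ∞ (christoffel G K I J) S) {X : APoint d → Comp d n}
    (hX : ∀ B, ContDiffOn ℝ ∞ (fun q => X q B) S) {p : APoint d} (hp : p ∈ S)
    (hG : ∀ I J, (G p)⁻¹ I J = (G p)⁻¹ J I) (A : Fin n → AIdx d) :
    box G X p A = (∑ I, ∑ J, (G p)⁻¹ I J * pd I (pd J fun q => X q A) p)
      - 2 * (∑ s, ∑ L, ∑ J, (∑ I, (G p)⁻¹ I J * christoffel G L I (A s) p) *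
          pd J (fun q => X q (Function.update A s L)) p)
      - (∑ L, (∑ I, ∑ J, (G p)⁻¹ I J * christoffel G L I J p) * pd L (fun q => X q A) p)
      + boxZeroth G A p (X p) := by
  have hterm : ∀ I J, covDeriv G (covDeriv G X) p (Fin.cons I (Fin.cons J A)) =
      pd I (pd J fun q => X q A) p
      - (∑ s, ∑ L, christoffel G L J (A s) p * pd I (fun q => X q (Function.update A s L)) p)
      - (∑ s, ∑ L, christoffel G L I (A s) p * pd J (fun q => X q (Function.update A s L)) p)
      - (∑ L, christoffel G L I J p * pd L (fun q => X q A) p)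
      + ((∑ s, ∑ L, -pd I (christoffel G L J (A s)) p * X p (Function.update A s L)) +
      ((∑ L, christoffel G L I J p *
          ∑ s, ∑ K, christoffel G K L (A s) p * X p (Function.update A s K)) +
        ∑ s, ∑ L, christoffel G L I (A s) p *
          ∑ s', ∑ K, christoffel G K J (Function.update A s L s') p *
            X p (Function.update (Function.update A s L) s' K))) := by
    intro I J
    rw [covDeriv_covDeriv_cons, pd_covDeriv_cons hS hΓ hX hp]
    simp only [covDeriv_cons, mul_sub, Finset.sum_sub_distrib, Finset.sum_add_distrib, neg_mul,
      Finset.sum_neg_distrib]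
    ring
  -- The mixed terms come in two kinds, one from differentiating the inner connection term and one
  -- from the outer connection acting on the inner derivative. `h2` and `h1` bring both to the same
  -- normal form; `h1` needs the symmetry of the inverse metric. Hence the factor 2.
  have h2 : ∀ D : AIdx d → Fin n → AIdx d → ℝ,
      (∑ I, ∑ J, (G p)⁻¹ I J * ∑ s, ∑ L, christoffel G L I (A s) p * D J s L) =
      ∑ s, ∑ L, ∑ J, (∑ I, (G p)⁻¹ I J * christoffel G L I (A s) p) * D J s L := by
    intro D
    simp only [Finset.mul_sum, Finset.sum_mul]
    rw [Finset.sum_comm]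
    simp_rw [Finset.sum_comm (s := (Finset.univ : Finset (AIdx d)))
      (t := (Finset.univ : Finset (Fin n)))]
    refine Finset.sum_congr rfl fun s _ => ?_
    rw [Finset.sum_congr rfl fun J _ => Finset.sum_comm, Finset.sum_comm]
    simp only [mul_assoc]
  have h1 : ∀ D : AIdx d → Fin n → AIdx d → ℝ,
      (∑ I, ∑ J, (G p)⁻¹ I J * ∑ s, ∑ L, christoffel G L J (A s) p * D I s L) =
      ∑ s, ∑ L, ∑ J, (∑ I, (G p)⁻¹ I J * christoffel G L I (A s) p) * D J s L := by
    intro D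
    rw [← h2, Finset.sum_comm]
    simp_rw [hG]
  have h3 : (∑ I, ∑ J, (G p)⁻¹ I J * ∑ L, christoffel G L I J p * pd L (fun q => X q A) p) =
      ∑ L, (∑ I, ∑ J, (G p)⁻¹ I J * christoffel G L I J p) * pd L (fun q => X q A) p := by
    simp only [Finset.mul_sum, Finset.sum_mul]
    rw [Finset.sum_congr rfl fun J _ => Finset.sum_comm, Finset.sum_comm]
    simp only [mul_assoc]
  simp only [box, hterm, mul_add, mul_sub, Finset.sum_sub_distrib, Finset.sum_add_distrib]
  rw [h3, h2 (fun J s L => pd J (fun q => X q (Function.update A s L)) p),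
    h1 (fun J s L => pd J (fun q => X q (Function.update A s L)) p), boxZeroth]
  simp only [mul_add, Finset.sum_add_distrib]
  ring

end Box

end AmbientTractor

/-! ### The ambient metric: inverse and Christoffel symbols. -/

namespace AmbientTractor

variable {d n : ℕ}

lemma isOpen_cone {W : Set (TPoint d)} (hW : IsOpen W) : IsOpen (cone W) :=
  (isOpen_lt continuous_const continuous_fst).inter (hW.preimage continuous_snd)

lemma contDiffOn_matrix_det {E ι : Type*} [NormedAddCommGroup E] [NormedSpace ℝ E] [Fintype ι]
    [DecidableEq ι] {S : Set E} {M : E → Matrix ι ι ℝ}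
    (hM : ∀ i j, ContDiffOn ℝ ∞ (fun q => M q i j) S) :
    ContDiffOn ℝ ∞ (fun q => (M q).det) S := by
  simp only [Matrix.det_apply']
  exact ContDiffOn.sum fun σ _ => contDiffOn_const.mul (contDiffOn_prod fun i _ => hM _ _)

/-- Cramer's rule: the entries of the adjugate are determinants of the matrix with one row replaced
by a constant one. -/
lemma contDiffOn_matrix_inv {E ι : Type*} [NormedAddCommGroup E] [NormedSpace ℝ E] [Fintype ι]
    [DecidableEq ι] {S : Set E} {M : E → Matrix ι ι ℝ}
    (hM : ∀ i j, ContDiffOn ℝ ∞ (fun q => M q i j) S) (hdet : ∀ q ∈ S, (M q).det ≠ 0)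
    (i j : ι) : ContDiffOn ℝ ∞ (fun q => (M q)⁻¹ i j) S := by
  simp only [Matrix.inv_def, Matrix.smul_apply, Ring.inverse_eq_inv', Matrix.adjugate_apply]
  refine ((contDiffOn_matrix_det hM).inv hdet).smul (contDiffOn_matrix_det fun a b => ?_)
  by_cases h : a = j
  · subst h
    simpa using contDiffOn_const
  · simpa [Matrix.updateRow_ne h] using hM a b

/-- The inverse of the ambient metric. -/
def ambientInverse (g : TPoint d → Matrix (Fin d) (Fin d) ℝ) (p : APoint d) :
    Matrix (AIdx d) (AIdx d) ℝ
  | Sum.inl _, Sum.inr (Sum.inr _) => p.1⁻¹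
  | Sum.inr (Sum.inr _), Sum.inl _ => p.1⁻¹
  | Sum.inr (Sum.inr _), Sum.inr (Sum.inr _) => -2 * p.2.2 * (p.1 ^ 2)⁻¹
  | Sum.inr (Sum.inl μ), Sum.inr (Sum.inl ν) => (p.1 ^ 2)⁻¹ * (g p.2)⁻¹ μ ν
  | _, _ => 0

section Metric

variable {W : Set (TPoint d)} {g : TPoint d → Matrix (Fin d) (Fin d) ℝ}

/-- The metric splits into the block t² g̃ and the (t, ρ) block with rows (2ρ, t) and (t, 0), whose
inverse has rows (0, 1/t) and (1/t, -2ρ/t²). -/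
lemma ambientMetric_inv (hdet : ∀ q ∈ W, (g q).det ≠ 0) {p : APoint d} (hp : p ∈ cone W) :
    (ambientMetric g p)⁻¹ = ambientInverse g p := by
  have ht : p.1 ≠ 0 := hp.1.ne'
  have hg : g p.2 * (g p.2)⁻¹ = 1 :=
    Matrix.mul_nonsing_inv _ (isUnit_iff_ne_zero.mpr (hdet _ hp.2))
  refine Matrix.inv_eq_right_inv ?_
  ext I J
  rcases I with _ | μ | _ <;> rcases J with _ | ν | _ <;>
    simp [Matrix.mul_apply, ambientMetric, ambientInverse, Matrix.one_apply, ht]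
  · field_simp
    ring
  · have h1 := congrFun (congrFun hg μ) ν
    rw [Matrix.mul_apply, Matrix.one_apply] at h1
    rw [← h1]
    refine Finset.sum_congr rfl fun k _ => ?_
    field_simp

lemma ambientInverse_symm (hsymm : ∀ q ∈ W, (g q).IsSymm) {p : APoint d} (hp : p ∈ cone W)
    (I J : AIdx d) : ambientInverse g p I J = ambientInverse g p J I := by
  have h : ((g p.2)⁻¹).IsSymm := (hsymm _ hp.2).inv
  rcases I with _ | μ | _ <;> rcases J with _ | ν | _ <;> simp [ambientInverse, h.apply]

lemma contDiffOn_ambientMetric (hg : ∀ μ ν, ContDiffOn ℝ ∞ (fun q => g q μ ν) W)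
    (I J : AIdx d) : ContDiffOn ℝ ∞ (fun p => ambientMetric g p I J) (cone W) := by
  have h : ∀ μ ν, ContDiffOn ℝ ∞ (fun p : APoint d => p.1 ^ 2 * g p.2 μ ν) (cone W) :=
    fun μ ν => (contDiff_fst.pow 2).contDiffOn.mul
      ((hg μ ν).comp contDiff_snd.contDiffOn fun p hp => hp.2)
  rcases I with _ | μ | _ <;> rcases J with _ | ν | _ <;> simp only [ambientMetric] <;>
    first | exact h _ _ | fun_prop

lemma contDiffOn_ambientMetric_inv (hg : ∀ μ ν, ContDiffOn ℝ ∞ (fun q => g q μ ν) W)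
    (hdet : ∀ q ∈ W, (g q).det ≠ 0) (I J : AIdx d) :
    ContDiffOn ℝ ∞ (fun p => (ambientMetric g p)⁻¹ I J) (cone W) := by
  refine ContDiffOn.congr (f := fun p => ambientInverse g p I J) ?_
    fun p hp => by rw [ambientMetric_inv hdet hp]
  have h1 : ContDiffOn ℝ ∞ (fun p : APoint d => p.1⁻¹) (cone W) :=
    contDiff_fst.contDiffOn.inv fun p hp => hp.1.ne'
  have h2 : ContDiffOn ℝ ∞ (fun p : APoint d => (p.1 ^ 2)⁻¹) (cone W) :=
    (contDiff_fst.pow 2).contDiffOn.inv fun p hp => (pow_pos hp.1 2).ne'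
  have h : ∀ μ ν, ContDiffOn ℝ ∞ (fun p : APoint d => (p.1 ^ 2)⁻¹ * (g p.2)⁻¹ μ ν) (cone W) :=
    fun μ ν => h2.mul
      ((contDiffOn_matrix_inv hg hdet μ ν).comp contDiff_snd.contDiffOn fun p hp => hp.2)
  rcases I with _ | μ | _ <;> rcases J with _ | ν | _ <;> simp only [ambientInverse] <;>
    first | exact h _ _ | exact h1 | exact contDiffOn_const | skip
  exact ContDiffOn.mul (by fun_prop) h2

lemma contDiffOn_christoffel (hW : IsOpen W)
    (hg : ∀ μ ν, ContDiffOn ℝ ∞ (fun q => g q μ ν) W)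
    (hdet : ∀ q ∈ W, (g q).det ≠ 0) (K I J : AIdx d) :
    ContDiffOn ℝ ∞ (christoffel (ambientMetric g) K I J) (cone W) := by
  have h : ∀ I J K, ContDiffOn ℝ ∞ (pd K fun p => ambientMetric g p I J) (cone W) :=
    fun I J K => contDiffOn_fderiv_apply (isOpen_cone hW) (contDiffOn_ambientMetric hg I J) _
  exact contDiffOn_const.mul (ContDiffOn.sum fun L _ =>
    (contDiffOn_ambientMetric_inv hg hdet K L).mul (((h J L I).add (h I L J)).sub (h I J L)))

/-- The product rule for a function of `t` times a function on `M × ℝ`. -/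
lemma pd_mul {a : ℝ → ℝ} {a' : ℝ} {φ : TPoint d → ℝ} {p : APoint d} (ha : HasDerivAt a a' p.1)
    (hφ : DifferentiableAt ℝ φ p.2) (I : AIdx d) :
    pd I (fun q => a q.1 * φ q.2) p =
      a' * (coordVec I).1 * φ p.2 + a p.1 * fderiv ℝ φ p.2 (coordVec I).2 := by
  have h1 : HasFDerivAt (fun q : APoint d => a q.1) _ p := 
    HasDerivAt.comp_hasFDerivAt (f := Prod.fst) p ha (ContinuousLinearMap.fst ℝ ℝ (TPoint d)).hasFDerivAt
  have h2 : HasFDerivAt (fun q : APoint d => φ q.2) _ p :=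
    HasFDerivAt.comp (f := Prod.snd) p hφ.hasFDerivAt
      (ContinuousLinearMap.snd ℝ ℝ (TPoint d)).hasFDerivAt
  rw [pd, (h1.fun_mul h2).fderiv]
  simp
  ring

lemma pd_two_mul_rho (I : AIdx d) (p : APoint d) :
    pd I (fun q => 2 * q.2.2) p = 2 * (coordVec I).2.2 := by
  have h := pd_mul (φ := fun r : TPoint d => r.2) (hasDerivAt_const p.1 (2 : ℝ))
    differentiableAt_snd I
  have h' : fderiv ℝ (fun r : TPoint d => r.2) p.2 = _ := fderiv_snd
  rw [h, h']
  simp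

lemma pd_fst (I : AIdx d) (p : APoint d) : pd I (fun q => q.1) p = (coordVec I).1 := by
  have h : fderiv ℝ (fun q : APoint d => q.1) p = _ := fderiv_fst
  rw [pd, h]
  rfl

lemma pd_sq_mul (hW : IsOpen W) (hg : ∀ μ ν, ContDiffOn ℝ ∞ (fun q => g q μ ν) W)
    {p : APoint d} (hp : p ∈ cone W) (I : AIdx d) (μ ν : Fin d) :
    pd I (fun q => q.1 ^ 2 * g q.2 μ ν) p = 2 * p.1 * (coordVec I).1 * g p.2 μ ν
        + p.1 ^ 2 * fderiv ℝ (fun q => g q μ ν) p.2 (coordVec I).2 := by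
  have h : HasDerivAt (fun t : ℝ => t ^ 2) (2 * p.1) p.1 := by
    simpa using hasDerivAt_pow 2 p.1
  exact pd_mul h (differentiableAt_of_mem hW (hg μ ν) hp.2) I

lemma pd_zero (I : AIdx d) (p : APoint d) : pd I (fun _ => (0 : ℝ)) p = 0 := by
  simp [pd]

/-- This is the identity ∇T = id for T = t ∂_t: the derivative of the component t accounts for the
0-0 entry, so Γ^K_{00} = 0, and t Γ^K_{0J} = δ^K_J for the other J. -/
lemma christoffel_zero (hW : IsOpen W) (hg : ∀ μ ν, ContDiffOn ℝ ∞ (fun q => g q μ ν) W)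
    (hsymm : ∀ q ∈ W, (g q).IsSymm) (hdet : ∀ q ∈ W, (g q).det ≠ 0) {p : APoint d} (hp : p ∈ cone W) (K J : AIdx d) :
    christoffel (ambientMetric g) K (AIdx.zero d) J p =
      if K = J ∧ J ≠ AIdx.zero d then p.1⁻¹ else 0 := by
  have ht : p.1 ≠ 0 := hp.1.ne'
  have hginv : (g p.2)⁻¹ * g p.2 = 1 :=
    Matrix.nonsing_inv_mul _ (isUnit_iff_ne_zero.mpr (hdet _ hp.2))
  rw [christoffel, ambientMetric_inv hdet hp]
  rcases J with _ | ν | _ <;> rcases K with _ | μ | _ <;>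
    simp [ambientInverse, pd_two_mul_rho, pd_fst, pd_sq_mul hW hg hp, coordVec, pd_zero,
      ambientMetric]
  · exact Or.inr (by norm_num)
  · exact Or.inr (by norm_num)
  · have h1 := congrFun (congrFun hginv μ) ν
    rw [Matrix.mul_apply, Matrix.one_apply] at h1
    have h2 : (if μ = ν then p.1⁻¹ else 0) = p.1⁻¹ * if μ = ν then 1 else 0 := by simp
    rw [h2, ← h1, Finset.mul_sum, Finset.mul_sum]
    refine Finset.sum_congr rfl fun κ _ => ?_
    have h3 : fderiv ℝ (fun q => g q ν κ) p.2 (0, 0) = 0 := map_zero _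
    rw [h3, (hsymm _ hp.2).apply κ ν]
    field_simp
    ring
  · field_simp

lemma christoffel_infty_base (hW : IsOpen W)
    (hg : ∀ μ ν, ContDiffOn ℝ ∞ (fun q => g q μ ν) W)
    (hdet : ∀ q ∈ W, (g q).det ≠ 0) {p : APoint d} (hp : p ∈ cone W) (μ ν : Fin d) :
    christoffel (ambientMetric g) (AIdx.infty d) (AIdx.base μ) (AIdx.base ν) p =
      -g p.2 μ ν + p.2.2 * rhoDeriv (fun q => g q μ ν) p.2 := by
  have ht : p.1 ≠ 0 := hp.1.ne'
  rw [christoffel, ambientMetric_inv hdet hp]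
  simp [ambientInverse, pd_sq_mul hW hg hp, coordVec, pd_zero, ambientMetric]
  have h3 : fderiv ℝ (fun q => g q μ ν) p.2 (0, 0) = 0 := map_zero _
  rw [h3, rhoDeriv]
  field_simp
  ring

lemma christoffel_infty_infty_zero
    (hdet : ∀ q ∈ W, (g q).det ≠ 0) {p : APoint d} (hp : p ∈ cone W) :
    christoffel (ambientMetric g) (AIdx.infty d) (AIdx.infty d) (AIdx.zero d) p = p.1⁻¹ := by
  have ht : p.1 ≠ 0 := hp.1.ne'
  rw [christoffel, ambientMetric_inv hdet hp]
  simp [ambientInverse, pd_two_mul_rho, pd_fst, coordVec, pd_zero, ambientMetric]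
  field_simp

lemma christoffel_infty_infty_infty
    (hdet : ∀ q ∈ W, (g q).det ≠ 0) {p : APoint d} (hp : p ∈ cone W) :
    christoffel (ambientMetric g) (AIdx.infty d) (AIdx.infty d) (AIdx.infty d) p = 0 := by
  have ht : p.1 ≠ 0 := hp.1.ne'
  rw [christoffel, ambientMetric_inv hdet hp]
  simp [ambientInverse, pd_fst, coordVec, pd_zero, ambientMetric]

end Metric

end AmbientTractor

/-! ### Homogeneous extensions and their derivatives at t = 1. -/

namespace AmbientTractor

variable {d n : ℕ} {W : Set (TPoint d)} {w : ℝ}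

/-- The number of indices `0` of a component of an `n`-covector. -/
def zeroCount (A : Fin n → AIdx d) : ℝ := ∑ s, if A s = AIdx.zero d then 1 else 0

lemma lieDeriv_eulerField (X : APoint d → Comp d n) (p : APoint d) (A : Fin n → AIdx d) :
    lieDeriv eulerField X p A =
      p.1 * pd (AIdx.zero d) (fun q => X q A) p + zeroCount A * X p A := by
  rw [lieDeriv, zeroCount, Finset.sum_mul]
  congr 1
  · simp [Fintype.sum_sum_type, eulerField]
  · refine Finset.sum_congr rfl fun s _ => ?_
    simp only [Fintype.sum_sum_type, eulerField, pd_zero, pd_fst]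
    rcases h : A s with _ | _ | _
    · have h1 : Function.update A s (Sum.inl ()) = A := by
        rw [← h]
        exact Function.update_eq_self s A
      simp [coordVec, h1]
    · simp [coordVec]
    · simp [coordVec]

lemma pd_congr (hW : IsOpen W) {f f' : APoint d → ℝ} (h : EqOn f f' (cone W)) {p : APoint d}
    (hp : p ∈ cone W) (I : AIdx d) : pd I f p = pd I f' p := by
  rw [pd, pd, fderiv_congr_of_eqOn (isOpen_cone hW) h hp]

lemma mem_cone_one {q : TPoint d} (hq : q ∈ W) : ((1 : ℝ), q) ∈ cone W := ⟨one_pos, hq⟩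

lemma hasDerivAt_rpow {t : ℝ} (ht : 0 < t) (a : ℝ) :
    HasDerivAt (fun t : ℝ => t ^ a) (a * t ^ (a - 1)) t :=
  Real.hasDerivAt_rpow_const (Or.inl ht.ne')

namespace IsWeightExtension

variable {Xt : TPoint d → Comp d n} {X : APoint d → Comp d n}

lemma apply_eq (hW : IsOpen W) (h : IsWeightExtension W w Xt X) (A : Fin n → AIdx d) :
    EqOn (fun p => X p A) (fun p => p.1 ^ (w - zeroCount A) * Xt p.2 A) (cone W) := by
  rintro ⟨t, q⟩ ⟨ht, hq⟩
  have hX := contDiffOn_pi.mp h.smooth A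
  -- Integrating factor: the weight equation says that r^(z(A) - w) X_A is constant along the ray r
  -- > 0, and its value is read off at r = 1.
  have hd : ∀ r ∈ Ioi (0 : ℝ),
      HasDerivAt (fun r : ℝ => r ^ (zeroCount A - w) * X (r, q) A) 0 r := by
    intro r hr
    have hp : ((r, q) : APoint d) ∈ cone W := ⟨hr, hq⟩
    have h1 : HasDerivAt (fun r : ℝ => ((r, q) : APoint d)) (1, 0) r :=
      (hasDerivAt_id r).prodMk (hasDerivAt_const r q)
    have h2 : HasDerivAt (fun r : ℝ => X (r, q) A) (pd (AIdx.zero d) (fun p => X p A) (r, q)) r :=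
      HasFDerivAt.comp_hasDerivAt (l := fun p => X p A) r
        (differentiableAt_of_mem (isOpen_cone hW) hX hp).hasFDerivAt h1
    refine ((hasDerivAt_rpow hr _).mul h2).congr_deriv ?_
    have h3 := congrFun (h.weight _ hp) A
    rw [lieDeriv_eulerField, Pi.smul_apply, smul_eq_mul] at h3
    have h4 : r ^ (zeroCount A - w) = r ^ (zeroCount A - w - 1) * r := by
      rw [← Real.rpow_add_one (ne_of_gt hr), sub_add_cancel]
    rw [h4]
    simp only at h3
    linear_combination r ^ (zeroCount A - w - 1) * h3
  have h5 := isOpen_Ioi.is_const_of_deriv_eq_zero isPreconnected_Ioi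
    (fun r hr => (hd r hr).differentiableAt.differentiableWithinAt)
    (fun r hr => (hd r hr).deriv) ht (mem_Ioi.mpr one_pos)
  simp only [Real.one_rpow, one_mul, h.restrict q hq] at h5
  have h6 : t ^ (w - zeroCount A) * t ^ (zeroCount A - w) = 1 := by
    rw [← Real.rpow_add ht]
    simp
  simp only [← h5]
  rw [← mul_assoc, h6, one_mul]

lemma eqOn (hW : IsOpen W) {X' : APoint d → Comp d n} (h : IsWeightExtension W w Xt X)
    (h' : IsWeightExtension W w Xt X') : EqOn X X' (cone W) := fun _ hp =>
  funext fun A => (h.apply_eq hW A hp).trans (h'.apply_eq hW A hp).symm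

lemma exists_extension (hW : IsOpen W) (w : ℝ) (hXt : ContDiffOn ℝ ∞ Xt W) :
    ∃ X : APoint d → Comp d n, IsWeightExtension W w Xt X := by
  refine ⟨fun p A => p.1 ^ (w - zeroCount A) * Xt p.2 A, ?_, ?_, ?_⟩
  · refine contDiffOn_pi.mpr fun A => ContDiffOn.mul ?_
      ((contDiffOn_pi.mp hXt A).comp contDiff_snd.contDiffOn fun p hp => hp.2)
    exact contDiff_fst.contDiffOn.rpow_const_of_ne fun p hp => hp.1.ne'
  · intro p hp
    funext A
    have ht : (0 : ℝ) < p.1 := hp.1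
    rw [lieDeriv_eulerField, pd_mul (hasDerivAt_rpow ht _)
      (differentiableAt_of_mem hW (contDiffOn_pi.mp hXt A) hp.2)]
    have h4 : p.1 ^ (w - zeroCount A) = p.1 ^ (w - zeroCount A - 1) * p.1 := by
      rw [← Real.rpow_add_one ht.ne', sub_add_cancel]
    have h5 : fderiv ℝ (fun q => Xt q A) p.2 (coordVec (AIdx.zero d)).2 = 0 := map_zero _
    simp only [h5, h4, Pi.smul_apply, smul_eq_mul]
    simp only [coordVec]
    ring
  · intro q _
    funext A
    simp

lemma pd_eq (hW : IsOpen W) (hXt : ContDiffOn ℝ ∞ Xt W) (h : IsWeightExtension W w Xt X)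
    (I : AIdx d) (A : Fin n → AIdx d) {p : APoint d} (hp : p ∈ cone W) :
    pd I (fun q => X q A) p =
      (w - zeroCount A) * p.1 ^ (w - zeroCount A - 1) * (coordVec I).1 * Xt p.2 A
        + p.1 ^ (w - zeroCount A) * fderiv ℝ (fun q => Xt q A) p.2 (coordVec I).2 := by
  rw [pd_congr hW (h.apply_eq hW A) hp]
  exact pd_mul (hasDerivAt_rpow hp.1 _)
    (differentiableAt_of_mem hW (contDiffOn_pi.mp hXt A) hp.2) I

lemma pd_zero_eq (hW : IsOpen W) (hXt : ContDiffOn ℝ ∞ Xt W) (h : IsWeightExtension W w Xt X)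
    (A : Fin n → AIdx d) : EqOn (pd (AIdx.zero d) fun q => X q A)
    (fun p => ((w - zeroCount A) * p.1 ^ (w - zeroCount A - 1)) * Xt p.2 A) (cone W) := by
  intro p hp
  have h5 : fderiv ℝ (fun q => Xt q A) p.2 (coordVec (AIdx.zero d)).2 = 0 := map_zero _
  rw [pd_eq hW hXt h _ A hp, h5]
  simp [coordVec]

lemma pd_base_eq (hW : IsOpen W) (hXt : ContDiffOn ℝ ∞ Xt W) (h : IsWeightExtension W w Xt X)
    (μ : Fin d) (A : Fin n → AIdx d) : EqOn (pd (AIdx.base μ) fun q => X q A)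
    (fun p => p.1 ^ (w - zeroCount A) * dBase μ Xt p.2 A) (cone W) := by
  intro p hp
  rw [pd_eq hW hXt h _ A hp]
  simp [coordVec, dBase]

lemma pd_infty_eq (hW : IsOpen W) (hXt : ContDiffOn ℝ ∞ Xt W) (h : IsWeightExtension W w Xt X)
    (A : Fin n → AIdx d) : EqOn (pd (AIdx.infty d) fun q => X q A)
    (fun p => p.1 ^ (w - zeroCount A) * dInf Xt p.2 A) (cone W) := by
  intro p hp
  rw [pd_eq hW hXt h _ A hp]
  simp [coordVec, dInf]

lemma pd_zero_pd_infty (hW : IsOpen W) (hXt : ContDiffOn ℝ ∞ Xt W) (h : IsWeightExtension W w Xt X)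
    (A : Fin n → AIdx d) {q : TPoint d} (hq : q ∈ W) :
    pd (AIdx.zero d) (pd (AIdx.infty d) fun q => X q A) (1, q) =
      (w - zeroCount A) * dInf Xt q A := by
  rw [pd_congr hW (pd_infty_eq hW hXt h A) (mem_cone_one hq),
    pd_mul (p := (1, q)) (hasDerivAt_rpow one_pos _)
      (differentiableAt_of_mem hW (contDiffOn_pi.mp (contDiffOn_dInf hW hXt) A) hq)]
  have h5 : fderiv ℝ (fun q => dInf Xt q A) q (coordVec (AIdx.zero d)).2 = 0 := map_zero _
  simp only [h5]
  simp [coordVec]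

lemma pd_infty_pd_zero (hW : IsOpen W) (hXt : ContDiffOn ℝ ∞ Xt W) (h : IsWeightExtension W w Xt X)
    (A : Fin n → AIdx d) {q : TPoint d} (hq : q ∈ W) :
    pd (AIdx.infty d) (pd (AIdx.zero d) fun q => X q A) (1, q) =
      (w - zeroCount A) * dInf Xt q A := by
  rw [pd_congr hW (pd_zero_eq hW hXt h A) (mem_cone_one hq),
    pd_mul (p := (1, q)) ((hasDerivAt_rpow one_pos _).const_mul _)
      (differentiableAt_of_mem hW (contDiffOn_pi.mp hXt A) hq)]
  simp [coordVec, dInf]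

lemma pd_infty_pd_infty (hW : IsOpen W) (hXt : ContDiffOn ℝ ∞ Xt W) (h : IsWeightExtension W w Xt X)
    (A : Fin n → AIdx d) {q : TPoint d} (hq : q ∈ W) :
    pd (AIdx.infty d) (pd (AIdx.infty d) fun q => X q A) (1, q) = dInf (dInf Xt) q A := by
  rw [pd_congr hW (pd_infty_eq hW hXt h A) (mem_cone_one hq),
    pd_mul (p := (1, q)) (hasDerivAt_rpow one_pos _)
      (differentiableAt_of_mem hW (contDiffOn_pi.mp (contDiffOn_dInf hW hXt) A) hq)]
  simp [coordVec, dInf]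

lemma pd_base_pd_base (hW : IsOpen W) (hXt : ContDiffOn ℝ ∞ Xt W) (h : IsWeightExtension W w Xt X)
    (μ ν : Fin d) (A : Fin n → AIdx d) {q : TPoint d} (hq : q ∈ W) :
    pd (AIdx.base μ) (pd (AIdx.base ν) fun q => X q A) (1, q) = dBase μ (dBase ν Xt) q A := by
  rw [pd_congr hW (pd_base_eq hW hXt h ν A) (mem_cone_one hq),
    pd_mul (p := (1, q)) (hasDerivAt_rpow one_pos _)
      (differentiableAt_of_mem hW (contDiffOn_pi.mp (contDiffOn_dBase hW hXt ν) A) hq)]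
  simp [coordVec, dBase]

end IsWeightExtension

end AmbientTractor

/-! ### The d'Alembert operator on weighted fields, and its remainder. -/

namespace AmbientTractor

variable {d n : ℕ} {W : Set (TPoint d)} {g : TPoint d → Matrix (Fin d) (Fin d) ℝ}

/-- The coefficient of `-2 ∂_J X_{A[s ↦ L]}` in `∇^I ∇_I X_A`. -/
def mixedCoeff (g : TPoint d → Matrix (Fin d) (Fin d) ℝ) (A : Fin n → AIdx d) (s : Fin n)
    (L J : AIdx d) (q : TPoint d) : ℝ :=
  ∑ I, (ambientMetric g (1, q))⁻¹ I J * christoffel (ambientMetric g) L I (A s) (1, q)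

/-- The contraction `g^{IJ} Γ^L_{IJ}` at `t = 1`. -/
def contractedChristoffel (g : TPoint d → Matrix (Fin d) (Fin d) ℝ) (L : AIdx d)
    (q : TPoint d) : ℝ :=
  ∑ I, ∑ J, (ambientMetric g (1, q))⁻¹ I J * christoffel (ambientMetric g) L I J (1, q)

/-- The trace `g̃^{μν} ∂_ρ g̃_{μν}`. -/
def rhoTrace (g : TPoint d → Matrix (Fin d) (Fin d) ℝ) (q : TPoint d) : ℝ :=
  ∑ μ, ∑ ν, (g q)⁻¹ μ ν * rhoDeriv (fun r => g r μ ν) q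

/-- The component `A` of the part of the d'Alembert operator on fields of weight `w` that
contains no second derivatives, and `∂_∞` only multiplied by `ρ`. -/
def boxRemainder (g : TPoint d → Matrix (Fin d) (Fin d) ℝ) (w : ℝ) (A : Fin n → AIdx d)
    (Xt : TPoint d → Comp d n) (q : TPoint d) : ℝ :=
  (-2) * (∑ s, ∑ L,
      (mixedCoeff g A s L (AIdx.zero d) q *
          ((w - zeroCount (Function.update A s L)) * Xt q (Function.update A s L)) +
        ((∑ μ, mixedCoeff g A s L (AIdx.base μ) q * dBase μ Xt q (Function.update A s L)) +
          (-2 * christoffel (ambientMetric g) L (AIdx.infty d) (A s) (1, q)) *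
            (q.2 * dInf Xt q (Function.update A s L))))) +
    ((-1) * (contractedChristoffel g (AIdx.zero d) q * ((w - zeroCount A) * Xt q A) +
        ((∑ μ, contractedChristoffel g (AIdx.base μ) q * dBase μ Xt q A) +
          rhoTrace g q * (q.2 * dInf Xt q A))) +
      boxZeroth (ambientMetric g) A (1, q) (Xt q))

lemma contDiffOn_restrict {f : APoint d → ℝ} (hf : ContDiffOn ℝ ∞ f (cone W)) :
    ContDiffOn ℝ ∞ (fun q => f (1, q)) W :=
  hf.comp (f := fun q : TPoint d => ((1 : ℝ), q)) (by fun_prop) fun _ hq => mem_cone_one hq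

lemma isJetTriangular_boxZeroth (hW : IsOpen W)
    (hg : ∀ μ ν, ContDiffOn ℝ ∞ (fun q => g q μ ν) W) (hdet : ∀ q ∈ W, (g q).det ≠ 0)
    (A : Fin n → AIdx d) :
    IsJetTriangular W fun (Xt : TPoint d → Comp d n) q =>
      boxZeroth (ambientMetric g) A (1, q) (Xt q) := by
  have hG := fun I J => contDiffOn_restrict (contDiffOn_ambientMetric_inv hg hdet I J)
  have hΓ := fun K I J => contDiffOn_restrict (contDiffOn_christoffel hW hg hdet K I J)
  have hdΓ : ∀ L K I J, ContDiffOn ℝ ∞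
      (fun q => -pd L (christoffel (ambientMetric g) K I J) (1, q)) W := fun L K I J =>
    (contDiffOn_restrict (contDiffOn_fderiv_apply (isOpen_cone hW)
      (contDiffOn_christoffel hW hg hdet K I J) (coordVec L))).neg
  have hc := fun B : Fin n → AIdx d => IsJetTriangular.component (W := W) B
  refine .sum hW _ fun I _ => .sum hW _ fun J _ => .mul hW (hG I J) (.add hW ?_ (.add hW ?_ ?_))
  · exact .sum hW _ fun s _ => .sum hW _ fun L _ => .mul hW (hdΓ I L J (A s)) (hc _)
  · exact .sum hW _ fun L _ => .mul hW (hΓ L I J) <|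
      .sum hW _ fun s _ => .sum hW _ fun K _ => .mul hW (hΓ K L (A s)) (hc _)
  · exact .sum hW _ fun s _ => .sum hW _ fun L _ => .mul hW (hΓ L I (A s)) <|
      .sum hW _ fun s' _ => .sum hW _ fun K _ =>
        .mul hW (hΓ K J (Function.update A s L s')) (hc _)

lemma isJetTriangular_boxRemainder (hW : IsOpen W)
    (hg : ∀ μ ν, ContDiffOn ℝ ∞ (fun q => g q μ ν) W) (hdet : ∀ q ∈ W, (g q).det ≠ 0)
    (w : ℝ) (A : Fin n → AIdx d) : IsJetTriangular W (boxRemainder g w A) := by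
  have hG := fun I J => contDiffOn_restrict (contDiffOn_ambientMetric_inv hg hdet I J)
  have hΓ := fun K I J => contDiffOn_restrict (contDiffOn_christoffel hW hg hdet K I J)
  have hm : ∀ s L J, ContDiffOn ℝ ∞ (mixedCoeff g A s L J) W := fun s L J =>
    ContDiffOn.sum fun I _ => (hG I J).mul (hΓ L I (A s))
  have hk : ∀ L, ContDiffOn ℝ ∞ (contractedChristoffel g L) W := fun L =>
    ContDiffOn.sum fun I _ => ContDiffOn.sum fun J _ => (hG I J).mul (hΓ L I J)
  have ht : ContDiffOn ℝ ∞ (rhoTrace g) W :=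
    ContDiffOn.sum fun μ _ => ContDiffOn.sum fun ν _ =>
      (contDiffOn_matrix_inv hg hdet μ ν).mul (contDiffOn_rhoDeriv hW (hg μ ν))
  have h0 := fun B : Fin n → AIdx d =>
    (IsJetTriangular.component (W := W) B).const_mul hW (w - zeroCount B)
  have h1 := fun μ (B : Fin n → AIdx d) => IsJetTriangular.dBase_component hW μ B
  have h2 := fun B : Fin n → AIdx d => IsJetTriangular.snd_mul_dInf_component hW B
  refine .add hW (.const_mul hW _ (.sum hW _ fun s _ => .sum hW _ fun L _ => ?_))
    (.add hW (.const_mul hW _ ?_) (isJetTriangular_boxZeroth hW hg hdet A))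
  · exact .add hW (.mul hW (hm s L _) (h0 _)) (.add hW
      (.sum hW _ fun μ _ => .mul hW (hm s L _) (h1 μ _))
      (.mul hW (contDiffOn_const.mul (hΓ L _ (A s))) (h2 _)))
  · exact .add hW (.mul hW (hk _) (h0 _)) (.add hW
      (.sum hW _ fun μ _ => .mul hW (hk _) (h1 μ _)) (.mul hW ht (h2 _)))

lemma sum_inv_mul_eq_card (hsymm : ∀ q ∈ W, (g q).IsSymm)
    (hdet : ∀ q ∈ W, (g q).det ≠ 0) {q : TPoint d} (hq : q ∈ W) :
    ∑ μ, ∑ ν, (g q)⁻¹ μ ν * g q μ ν = d := by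
  have h : (g q)⁻¹ * g q = 1 :=
    Matrix.nonsing_inv_mul _ (isUnit_iff_ne_zero.mpr (hdet _ hq))
  calc ∑ μ, ∑ ν, (g q)⁻¹ μ ν * g q μ ν = ((g q)⁻¹ * g q).trace := by
        simp only [Matrix.trace, Matrix.diag, Matrix.mul_apply]
        refine Finset.sum_congr rfl fun μ _ => Finset.sum_congr rfl fun ν _ => ?_
        rw [(hsymm q hq).apply]
    _ = d := by simp [h]

lemma contractedChristoffel_infty (hW : IsOpen W)
    (hg : ∀ μ ν, ContDiffOn ℝ ∞ (fun q => g q μ ν) W) (hsymm : ∀ q ∈ W, (g q).IsSymm)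
    (hdet : ∀ q ∈ W, (g q).det ≠ 0) {q : TPoint d} (hq : q ∈ W) :
    contractedChristoffel g (AIdx.infty d) q = 2 - d + q.2 * rhoTrace g q := by
  have hp := mem_cone_one hq
  have e1 := christoffel_zero hW hg hsymm hdet hp (AIdx.infty d) (AIdx.infty d)
  have e2 := christoffel_infty_infty_zero hdet hp
  have e3 := christoffel_infty_infty_infty hdet hp
  have e4 := christoffel_infty_base hW hg hdet hp
  rw [contractedChristoffel, ambientMetric_inv hdet hp]
  simp only [Fintype.sum_sum_type, ambientInverse, e1, e2, e3, e4]
  simp [mul_add, Finset.sum_add_distrib, sum_inv_mul_eq_card hsymm hdet hq, rhoTrace,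
    Finset.mul_sum, mul_left_comm]
  ring

/-- Column ∞ of the inverse metric at `t = 1` has only the entries g^{0∞} = 1 and g^{∞∞} = -2ρ, so
modulo ρ only Γ^L_{0 A_s} is left. -/
lemma mixedCoeff_infty (hdet : ∀ q ∈ W, (g q).det ≠ 0) (A : Fin n → AIdx d) (s : Fin n)
    (L : AIdx d) {q : TPoint d} (hq : q ∈ W) :
    mixedCoeff g A s L (AIdx.infty d) q =
      christoffel (ambientMetric g) L (AIdx.zero d) (A s) (1, q) +
        q.2 * (-2 * christoffel (ambientMetric g) L (AIdx.infty d) (A s) (1, q)) := by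
  rw [mixedCoeff, ambientMetric_inv hdet (mem_cone_one hq)]
  simp [Fintype.sum_sum_type, ambientInverse]
  ring

/-- Each of the n - z(A) indices different from 0 contributes `Y A` once, and the indices 0
contribute nothing. -/
lemma sum_christoffel_zero_mul (hW : IsOpen W)
    (hg : ∀ μ ν, ContDiffOn ℝ ∞ (fun q => g q μ ν) W) (hsymm : ∀ q ∈ W, (g q).IsSymm)
    (hdet : ∀ q ∈ W, (g q).det ≠ 0) {q : TPoint d} (hq : q ∈ W) (A : Fin n → AIdx d)
    (Y : Comp d n) :
    ∑ s, ∑ L, christoffel (ambientMetric g) L (AIdx.zero d) (A s) (1, q) *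
      Y (Function.update A s L) = (n - zeroCount A) * Y A := by
  have h : ∀ s, ∑ L, christoffel (ambientMetric g) L (AIdx.zero d) (A s) (1, q) *
      Y (Function.update A s L) = (1 - if A s = AIdx.zero d then 1 else 0) * Y A := by
    intro s
    rw [Finset.sum_eq_single (A s)]
    · rw [christoffel_zero hW hg hsymm hdet (mem_cone_one hq), Function.update_eq_self]
      by_cases h0 : A s = AIdx.zero d <;> simp [h0]
    · intro L _ hL
      rw [christoffel_zero hW hg hsymm hdet (mem_cone_one hq), if_neg fun h => hL h.1, zero_mul]
    · simp
  simp_rw [h, ← Finset.sum_mul, Finset.sum_sub_distrib]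
  simp [zeroCount]

lemma box_apply_eq (hW : IsOpen W)
    (hg : ∀ μ ν, ContDiffOn ℝ ∞ (fun q => g q μ ν) W) (hsymm : ∀ q ∈ W, (g q).IsSymm)
    (hdet : ∀ q ∈ W, (g q).det ≠ 0) {w : ℝ} {Xt : TPoint d → Comp d n}
    {X : APoint d → Comp d n} (hXt : ContDiffOn ℝ ∞ Xt W) (hX : IsWeightExtension W w Xt X)
    {q : TPoint d} (hq : q ∈ W) (A : Fin n → AIdx d) :
    box (ambientMetric g) X (1, q) A = principal g Xt q A
      + (((d : ℝ) - 2 + 2 * w - 2 * (n : ℝ)) * dInf Xt q A - (2 * q.2) * dInf (dInf Xt) q A)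
      + boxRemainder g w A Xt q := by
  have hp := mem_cone_one hq
  have hd0 : ∀ B, pd (AIdx.zero d) (fun q => X q B) (1, q) = (w - zeroCount B) * Xt q B :=
    fun B => by simpa using hX.pd_zero_eq hW hXt B hp
  have hdb : ∀ μ B, pd (AIdx.base μ) (fun q => X q B) (1, q) = dBase μ Xt q B :=
    fun μ B => by simpa using hX.pd_base_eq hW hXt μ B hp
  have hdi : ∀ B, pd (AIdx.infty d) (fun q => X q B) (1, q) = dInf Xt q B :=
    fun B => by simpa using hX.pd_infty_eq hW hXt B hp
  -- g^{0∞} and g^{∞0} both occur, which gives 2(w - z(A)).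
  have hsecond : (∑ I, ∑ J, (ambientMetric g (1, q))⁻¹ I J * pd I (pd J fun q => X q A) (1, q)) =
      2 * (w - zeroCount A) * dInf Xt q A - 2 * q.2 * dInf (dInf Xt) q A
        + principal g Xt q A := by
    have e1 := hX.pd_zero_pd_infty hW hXt A hq
    have e2 := hX.pd_infty_pd_zero hW hXt A hq
    have e3 := hX.pd_infty_pd_infty hW hXt A hq
    have e4 := fun μ ν => hX.pd_base_pd_base hW hXt μ ν A hq
    rw [ambientMetric_inv hdet hp]
    simp only [Fintype.sum_sum_type, ambientInverse, e1, e2, e3, e4]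
    simp [principal, Finset.sum_apply]
    ring
  -- The prefactor -2 in `box_eq` makes this -2(n - z(A)), which cancels the z(A) of the
  -- second-order part.
  have hmixed : (∑ s, ∑ L, ∑ J, mixedCoeff g A s L J q *
      pd J (fun q => X q (Function.update A s L)) (1, q)) =
      (n - zeroCount A) * dInf Xt q A + ∑ s, ∑ L,
      (mixedCoeff g A s L (AIdx.zero d) q *
          ((w - zeroCount (Function.update A s L)) * Xt q (Function.update A s L)) +
        ((∑ μ, mixedCoeff g A s L (AIdx.base μ) q * dBase μ Xt q (Function.update A s L)) +
          (-2 * christoffel (ambientMetric g) L (AIdx.infty d) (A s) (1, q)) *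
            (q.2 * dInf Xt q (Function.update A s L)))) := by
    rw [← sum_christoffel_zero_mul hW hg hsymm hdet hq, ← Finset.sum_add_distrib]
    refine Finset.sum_congr rfl fun s _ => ?_
    rw [← Finset.sum_add_distrib]
    refine Finset.sum_congr rfl fun L _ => ?_
    simp only [Fintype.sum_sum_type, Finset.univ_unique, Finset.sum_singleton]
    have e := mixedCoeff_infty hdet A s L hq
    simp only [PUnit.default_eq_unit, hd0, hdb, hdi, e]
    ring
  have hcontr : (∑ L, contractedChristoffel g L q * pd L (fun q => X q A) (1, q)) =
      (2 - d) * dInf Xt q A +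
      (contractedChristoffel g (AIdx.zero d) q * ((w - zeroCount A) * Xt q A) +
        ((∑ μ, contractedChristoffel g (AIdx.base μ) q * dBase μ Xt q A) +
          rhoTrace g q * (q.2 * dInf Xt q A))) := by
    have e := contractedChristoffel_infty hW hg hsymm hdet hq
    simp only [Fintype.sum_sum_type, Finset.univ_unique, Finset.sum_singleton,
      PUnit.default_eq_unit, hd0, hdb, hdi, e]
    ring
  have hbox := box_eq (isOpen_cone hW) (contDiffOn_christoffel hW hg hdet)
    (contDiffOn_pi.mp hX.smooth) hp
    (fun I J => by rw [ambientMetric_inv hdet hp, ambientInverse_symm hsymm hp]) A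
  rw [hbox, hsecond, hX.restrict q hq, boxRemainder]
  -- Definitional restatements with the coefficients unfolded, in the form in which they occur after
  -- `box_eq`.
  have hm' : (∑ s, ∑ L, ∑ J, (∑ I, (ambientMetric g (1, q))⁻¹ I J *
      christoffel (ambientMetric g) L I (A s) (1, q)) *
      pd J (fun q => X q (Function.update A s L)) (1, q)) = _ := hmixed
  have hc' : (∑ L, (∑ I, ∑ J, (ambientMetric g (1, q))⁻¹ I J *
      christoffel (ambientMetric g) L I J (1, q)) * pd L (fun q => X q A) (1, q)) = _ := hcontr
  rw [hm', hc']
  ring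

end AmbientTractor

/-! ### Taylor coefficients of the full formula. -/

namespace AmbientTractor

variable {d n : ℕ} {W : Set (TPoint d)}

lemma coeff_add {f f' : TPoint d → Comp d n} (hW : IsOpen W) (hf : ContDiffOn ℝ ∞ f W)
    (hf' : ContDiffOn ℝ ∞ f' W) (m : ℕ) {x : BPoint d} (hx : (x, (0 : ℝ)) ∈ W) :
    coeff m (fun q => f q + f' q) x = coeff m f x + coeff m f' x :=
  funext fun A => scoeff_add hW (contDiffOn_pi.mp hf A) (contDiffOn_pi.mp hf' A) m hx

lemma coeff_congr {f f' : TPoint d → Comp d n} (hW : IsOpen W) (h : EqOn f f' W) (m : ℕ)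
    {x : BPoint d} (hx : (x, (0 : ℝ)) ∈ W) : coeff m f x = coeff m f' x :=
  funext fun A => scoeff_congr hW (fun _ hq => congrFun (h hq) A) m hx

lemma contDiffOn_principal {g : TPoint d → Matrix (Fin d) (Fin d) ℝ} (hW : IsOpen W)
    (hg : ∀ μ ν, ContDiffOn ℝ ∞ (fun q => (g q)⁻¹ μ ν) W) {f : TPoint d → Comp d n}
    (hf : ContDiffOn ℝ ∞ f W) : ContDiffOn ℝ ∞ (principal g f) W := by
  have h : principal g f = fun q => ∑ μ, ∑ ν, (g q)⁻¹ μ ν • dBase μ (dBase ν f) q := rfl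
  rw [h]
  exact ContDiffOn.sum fun μ _ => ContDiffOn.sum fun ν _ =>
    (hg μ ν).smul (contDiffOn_dBase hW (contDiffOn_dBase hW hf ν) μ)

/-- The Taylor coefficients of `(c - 2ρ∂_∞)∂_∞ f`. -/
lemma coeff_transport {f : TPoint d → Comp d n} (hW : IsOpen W) (hf : ContDiffOn ℝ ∞ f W)
    (c : ℝ) (m : ℕ) {x : BPoint d} (hx : (x, (0 : ℝ)) ∈ W) :
    coeff m (fun q => c • dInf f q - (2 * q.2) • dInf (dInf f) q) x =
      ((c - 2 * m) * (m + 1)) • coeff (m + 1) f x := by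
  funext A
  have hA := contDiffOn_pi.mp hf A
  have hA' := contDiffOn_rhoDeriv hW hA
  have hρ : ContDiffOn ℝ ∞ (fun q : TPoint d => q.2 * rhoDeriv (rhoDeriv fun r => f r A) q) W :=
    contDiff_snd.contDiffOn.mul (contDiffOn_rhoDeriv hW hA')
  have h1 : (fun q => (c • dInf f q - (2 * q.2) • dInf (dInf f) q) A) = fun q =>
      c * rhoDeriv (fun r => f r A) q +
        (-2) * (q.2 * rhoDeriv (rhoDeriv fun r => f r A) q) := by
    funext q
    change c * rhoDeriv (fun r => f r A) q -
      (2 * q.2) * rhoDeriv (rhoDeriv fun r => f r A) q = _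
    ring
  -- ∂_ρ f contributes (m + 1) f^{[m+1]}, and ρ ∂_ρ applied to ∂_ρ f contributes m times that; hence
  -- the factor (c - 2m)(m + 1).
  rw [coeff, h1, scoeff_add hW (contDiffOn_const.mul hA') (contDiffOn_const.mul hρ) m hx,
    scoeff_const_mul hW hA' _ m hx, scoeff_const_mul hW hρ _ m hx,
    scoeff_snd_mul_rhoDeriv hW hA' m hx, scoeff_rhoDeriv hW hA m hx, Pi.smul_apply, coeff,
    smul_eq_mul]
  ring

end AmbientTractor

end

open AmbientTractor in
theorem mainTheorem9 (d n : ℕ) (w : ℝ) (W : Set (TPoint d)) (hW : IsOpen W)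
    (g : TPoint d → Matrix (Fin d) (Fin d) ℝ)
    (hg_smooth : ∀ μ ν, ContDiffOn ℝ ∞ (fun q => g q μ ν) W)
    (hg_symm : ∀ q ∈ W, (g q).IsSymm)
    (hg_nondeg : ∀ q ∈ W, (g q).det ≠ 0) :
    -- every smooth field on `W` has exactly one extension of weight `w`
    (∀ Xt : TPoint d → Comp d n, ContDiffOn ℝ ∞ Xt W →
      (∃ X, IsWeightExtension W w Xt X) ∧
      (∀ X X', IsWeightExtension W w Xt X → IsWeightExtension W w Xt X' →
        EqOn X X' (cone W))) ∧
    -- functions of first jets, linear and with smooth coefficients, the same for all fields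
    ∃ Φ : ∀ m : ℕ, BPoint d → ((Fin (m + 1) → Jet1 d n) →L[ℝ] Comp d n),
      (∀ m, ContDiffOn ℝ ∞ (Φ m) {x | (x, (0 : ℝ)) ∈ W}) ∧
      ∀ (Xt : TPoint d → Comp d n) (X : APoint d → Comp d n),
        ContDiffOn ℝ ∞ Xt W → IsWeightExtension W w Xt X →
        ∃ F : TPoint d → Comp d n, ContDiffOn ℝ ∞ F W ∧
          (∀ q ∈ W, restrictOne (box (ambientMetric g) X) q =
            principal g Xt q
              + (((d : ℝ) - 2 + 2 * w - 2 * (n : ℝ)) • dInf Xt q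
                  - (2 * q.2) • dInf (dInf Xt) q)
              + F q) ∧
          (∀ (m : ℕ) (x : BPoint d), (x, (0 : ℝ)) ∈ W →
            coeff m F x = Φ m x (fun k => jet1 (coeff (k : ℕ) Xt) x)) ∧
          (∀ (m : ℕ) (x : BPoint d), (x, (0 : ℝ)) ∈ W →
            coeff m (restrictOne (box (ambientMetric g) X)) x =
              coeff m (principal g Xt) x
                + (((d : ℝ) - 2 + 2 * w - 2 * (n : ℝ) - 2 * (m : ℝ)) * ((m : ℝ) + 1)) •
                    coeff (m + 1) Xt x
                + coeff m F x) ∧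
          (∀ (m : ℕ) (x : BPoint d), (x, (0 : ℝ)) ∈ W →
            coeff m (principal g Xt) x =
              ∑ k ∈ Finset.range (m + 1), ∑ μ, ∑ ν,
                scoeff (m - k) (fun q => (g q)⁻¹ μ ν) x •
                  dM μ (dM ν (coeff k Xt)) x) := by
  have hginv := contDiffOn_matrix_inv hg_smooth hg_nondeg
  refine ⟨fun Xt hXt => ⟨IsWeightExtension.exists_extension hW w hXt,
    fun X X' h h' => h.eqOn hW h'⟩, ?_⟩
  -- The jet maps are chosen component by component before any field is fixed, so they do not depend
  -- on `Xt`.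
  choose hFsmooth Ψ hΨ hFcoeff using
    fun A : Fin n → AIdx d => isJetTriangular_boxRemainder hW hg_smooth hg_nondeg w A
  refine ⟨fun m x => ContinuousLinearMap.pi fun A => Ψ A m x, fun m =>
    -- The jet space is finite-dimensional, so smoothness of a family of linear maps can be tested
    -- on single vectors.
    contDiffOn_clm_apply.mpr fun y => contDiffOn_pi.mpr fun A =>
      (hΨ A m).clm_apply contDiffOn_const, fun Xt X hXt hX => ?_⟩
  have hF : ContDiffOn ℝ ∞ (fun q A => boxRemainder g w A Xt q) W :=
    contDiffOn_pi.mpr fun A => hFsmooth A Xt hXt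
  have hbox : EqOn (restrictOne (box (ambientMetric g) X)) (fun q => principal g Xt q
      + (((d : ℝ) - 2 + 2 * w - 2 * (n : ℝ)) • dInf Xt q
          - (2 * q.2) • dInf (dInf Xt) q)
      + fun A => boxRemainder g w A Xt q) W := fun q hq => funext fun A =>
    box_apply_eq hW hg_smooth hg_symm hg_nondeg hXt hX hq A
  refine ⟨fun q A => boxRemainder g w A Xt q, hF, hbox,
    fun m x hx => funext fun A => hFcoeff A Xt hXt m x hx, fun m x hx => ?_,
    fun m x hx => coeff_principal hW hginv hXt m hx⟩
  have hP := contDiffOn_principal hW hginv hXt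
  have hD : ContDiffOn ℝ ∞ (fun q => ((d : ℝ) - 2 + 2 * w - 2 * (n : ℝ)) • dInf Xt q
      - (2 * q.2) • dInf (dInf Xt) q) W :=
    contDiffOn_pi.mpr fun A => ContDiffOn.sub
      (contDiffOn_const.mul (contDiffOn_pi.mp (contDiffOn_dInf hW hXt) A))
      ((contDiff_const.mul contDiff_snd).contDiffOn.mul
        (contDiffOn_pi.mp (contDiffOn_dInf hW (contDiffOn_dInf hW hXt)) A))
  rw [coeff_congr hW hbox m hx, coeff_add hW (hP.add hD) hF m hx, coeff_add hW hP hD m hx,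
    coeff_transport hW hXt _ m hx]
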